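/- **Setting.** An *agent* is a SISO system $\dot x_i=f_i(x_i,u_i)$, $y_i=h_i(x_i)$, an *edge controller* a SISO system $\dot\eta_e=\phi_e(\eta_e,\zeta_e)$, $\mu_e=\psi_e(\eta_e,\zeta_e)$, with finite-dimensional states (dimension $0$ allowed, i.e. static controllers) and continuous $f_i,h_i,\phi_e,\psi_e$. The steady-state relation of a system consists of the pairs (constant input, output at an equilibrium for that input); write $k_i$ for agents and $\gamma_e$ for controllers. A system with input $u$ and output $y$ is *passive* with index $\rho\ge 0$ with respect to a steady-state pair $(\bar u,\bar y)$ if there is a differentiable storage function $S\ge 0$ of the state with compact sublevel sets such that $\frac{d}{dt}S\le-\rho(y-\bar y)^2+(y-\bar y)(u-\bar u)$. It is *MEIP* if it is passive with respect to each of its steady-state pairs and its steady-state relation is maximally monotone; it is *output-strictly MEIP* if moreover the index can be taken positive for each pair. Let $\mathcal G=(\mathbb V,\mathbb E)$ be a finite simple graph, oriented arbitrarily, with incidence matrix $\mathcal E$. For $\mathcal H=(\mathbb V,\mathbb E_{\mathcal H})$ with $\mathbb E_{\mathcal H}\subseteq\mathbb E$ let $\mathcal E_{\mathcal H}$ consist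 of the columns of $\mathcal E$ in $\mathbb E_{\mathcal H}$ and let $P_{\mathcal H}:\mathbb R^{\mathbb E}\to\mathbb R^{\mathbb E_{\mathcal H}}$ be the restriction. With an interaction protocol $(\Pi,\mathrm w)$, where $\Pi=(\Pi_e)_{e\in\mathbb E}$ and $\mathrm w\in\mathbb R^{\mathbb E}$, the network with functioning edges $\mathbb E_{\mathcal H}$ is closed by $\zeta=\mathcal E_{\mathcal H}^\top y$, $u=-\mathcal E_{\mathcal H}(\mu+P_{\mathcal H}\mathrm w)$. It *converges to* $\bar{\mathrm y}$ if $y(t)\to\bar{\mathrm y}$ for all its trajectories on $[0,\infty)$. *Assumption 1.* Either the agents are MEIP with states of dimension at most $1$ and the controllers are output-strictly MEIP, or the agents are output-strictly MEIP (with states of any finite dimension) and the controllers are MEIP. Moreover $k_i^{-1}$ and $\gamma_e$ are $C^1$ functions $\mathbb R\to\mathbb R$, and $k_i^{-1}$ has positive derivative. (The agents satisfy Assumption 1 if the part that concerns them holds.) A *switching signal* assigns to each $t\ge0$ the functioning subgraph $\varsigma(t)$ of $\mathcal G$; it is *non-increasing* if $\varsigma(t_2)\subseteq\varsigma(t_1)$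 for $t_1<t_2$. A *convergence assertion algorithm* $\mathscr A$ receives a model (a subgraph $\mathcal H$ and a protocol satisfying Assumption 1) and a conjectured limit $\bar{\mathrm y}$, measures the states of the running network, and either stops and declares "no" or runs indefinitely; what it does up to time $t$ depends only on the measurements up to $t$. (a) If the modelled network (graph $\mathcal H$, without faults) converges to $\bar{\mathrm y}$, and it is this network that is measured up to time $t$, then $\mathscr A$ has not declared "no" up to $t$. (b) If the protocol is run with any non-increasing switching signal and the output does not converge to $\bar{\mathrm y}$, then $\mathscr A$ declares "no" in finite time. **Algorithm 5 (synthesis).** Let $\mathrm{Graphs}(1),\dots,\mathrm{Graphs}(N)$ be all graphs obtained from $\mathcal G$ by removing at most $r$ edges. Choose controllers $\Pi$ satisfying Assumption 1 such that for every $\mathrm w\in\mathbb R^{\mathbb E}$ and every $j$ the network with graph $\mathrm{Graphs}(j)$ and protocol $(\Pi,\mathrm w)$ has a steady-state output. For each $j$, with $\mathcal H=\mathrm{Graphs}(j)$, choose controllers $\Pi^j$ satisfying Assumption 1 which solve the synthesis problem for $\mathcal H$ (without bias, $\mathrm y^\star$ is a steady-state output of the network with graph $\mathcal H$, and the network converges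 to it), and a basis $(b^j_a)_a$ of $\ker\mathcal E_{\mathcal H}P_{\mathcal H}$. Draw non-degenerate Gaussian vectors $\mathrm w\in\mathbb R^{\mathbb E}$ and $\alpha^j$; put $\mathrm{IP}(j)=(\Pi^j,\sum_a\alpha^j_ab^j_a)$, and let $\mathrm{SSLimits}(j)$ be the steady-state output of the network with graph $\mathrm{Graphs}(j)$ and protocol $(\Pi,\mathrm w)$. **Algorithm 6 (in-run).** Start in the stable phase with $\mathrm{Graphs}(j)=\mathcal G$. *Stable phase $j$*: the agents use $\mathrm{IP}(j)$, and $\mathscr A$ is run for the graph $\mathrm{Graphs}(j)$, the protocol $\mathrm{IP}(j)$ and the limit $\mathrm y^\star$; when it declares "no", go to the exploratory phase. *Exploratory phase*: the agents use $(\Pi,\mathrm w)$, and $N$ instances of $\mathscr A$ are run, the $j$-th for the graph $\mathrm{Graphs}(j)$ and the limit $\mathrm{SSLimits}(j)$, until at most one of them has not declared "no"; if all have declared "no", restart the exploratory phase, otherwise go to the stable phase $j$ of the remaining instance $j$. The controllers' states may take any values when a phase begins. **Theorem.** Let the agents satisfy Assumption 1, let $\mathcal G$ be $k$-connected with $k\ge3$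 (more than $k$ vertices, and connected after the removal of any fewer than $k$ vertices), let $r=k-2$, and let $\mathrm y^\star\in\mathbb R^{\mathbb V}$ satisfy $\sum_i k_i^{-1}(\mathrm y^\star_i)=0$. Then: 1. $r<|\mathbb E|$, and there exist controllers and bases as required by the choices in Algorithm 5. 2. For all such choices and every convergence assertion algorithm $\mathscr A$, with probability 1 over the Gaussian vectors, Algorithms 5 and 6 solve the network fault detection and isolation problem: for every non-increasing switching signal $\varsigma$ with at most $r$ faulty edges at each time, every run of the closed loop under Algorithm 6 satisfies $y(t)\to\mathrm y^\star$ as $t\to\infty$. -/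

import Mathlib

open Filter Topology MeasureTheory
open scoped ENNReal

noncomputable section

namespace NetworkFDI

/-! ### Single-input single-output systems, steady states, passivity, MEIP -/

/-- The state space `ℝⁿ`. The case `n = 0` is a static (memoryless) system. -/
abbrev StateSpace (n : ℕ) : Type := EuclideanSpace ℝ (Fin n)

/-- A SISO system `ẋ = f(x, u)`, `y = h(x, u)` with continuous right-hand sides. -/
structure SISO where
  dim : ℕ
  f : StateSpace dim → ℝ → StateSpace dim
  h : StateSpace dim → ℝ → ℝ
  continuous_f : Continuous (Function.uncurry f)
  continuous_h : Continuous (Function.uncurry h)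

/-- An agent `ẋ = f(x, u)`, `y = h(x)`: the output is a function of the state only. -/
structure Agent where
  dim : ℕ
  f : StateSpace dim → ℝ → StateSpace dim
  h : StateSpace dim → ℝ
  continuous_f : Continuous (Function.uncurry f)
  continuous_h : Continuous h

/-- An agent as a SISO system. -/
def Agent.toSISO (a : Agent) : SISO where
  dim := a.dim
  f := a.f
  h := fun x _ => a.h x
  continuous_f := a.continuous_f
  continuous_h := a.continuous_h.comp continuous_fst

/-- The steady-state input-output relation: all pairs `(u, y)` for which the constant input `u`
admits an equilibrium with output `y`. -/
def SISO.rel (s : SISO) : Set (ℝ × ℝ) :=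
  {p | ∃ x : StateSpace s.dim, s.f x p.1 = 0 ∧ s.h x p.1 = p.2}

/-- `S` is a (positive semi-definite) storage function: differentiable, nonnegative, with compact
sublevel sets. -/
def IsStorage {n : ℕ} (S : StateSpace n → ℝ) : Prop :=
  Differentiable ℝ S ∧ (∀ x, 0 ≤ S x) ∧ ∀ c : ℝ, IsCompact {x | S x ≤ c}

/-- Passivity with respect to `(ū, ȳ)` with output index `ρ`:
`d/dt S(x) ≤ -ρ (y - ȳ)² + (y - ȳ)(u - ū)` for some storage function `S`, where `d/dt S(x)` is
the derivative of `S` along `ẋ = f(x, u)`. -/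
def SISO.IsPassiveAt (s : SISO) (ubar ybar ρ : ℝ) : Prop :=
  ∃ S : StateSpace s.dim → ℝ, IsStorage S ∧
    ∀ (x : StateSpace s.dim) (u : ℝ),
      fderiv ℝ S x (s.f x u) ≤
        -ρ * (s.h x u - ybar) ^ 2 + (s.h x u - ybar) * (u - ubar)

/-- A monotone relation in `ℝ × ℝ`. -/
def IsMonotoneRel (R : Set (ℝ × ℝ)) : Prop :=
  ∀ p ∈ R, ∀ q ∈ R, 0 ≤ (p.1 - q.1) * (p.2 - q.2)

/-- Maximal equilibrium-independent passivity. -/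
def SISO.IsMEIP (s : SISO) : Prop :=
  (∀ p ∈ s.rel, ∃ ρ : ℝ, 0 ≤ ρ ∧ s.IsPassiveAt p.1 p.2 ρ) ∧ Maximal IsMonotoneRel s.rel

/-- Output-strict maximal equilibrium-independent passivity. -/
def SISO.IsOutputStrictlyMEIP (s : SISO) : Prop :=
  (∀ p ∈ s.rel, ∃ ρ : ℝ, 0 < ρ ∧ s.IsPassiveAt p.1 p.2 ρ) ∧ Maximal IsMonotoneRel s.rel

/-! ### Graphs -/

/-- `k`-connected graphs: more than `k` vertices, and connected after the deletion of any set of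
fewer than `k` vertices. -/
def IsKConnected {V : Type*} [Fintype V] (G : SimpleGraph V) (k : ℕ) : Prop :=
  k < Fintype.card V ∧
    ∀ S : Finset V, S.card < k → (G.induce {v : V | v ∉ S}).Connected

/-- An arbitrary orientation of the edges: `e = (fst e, snd e)`. -/
structure EdgeOrientation {V : Type*} (G : SimpleGraph V) where
  fst : G.edgeSet → V
  snd : G.edgeSet → V
  spec : ∀ e : G.edgeSet, s(fst e, snd e) = (e : Sym2 V)

/-- The incidence matrix of `G`; that of a subgraph `H` consists of the columns in `H`. -/
def EdgeOrientation.incidence {V : Type*} [DecidableEq V] {G : SimpleGraph V}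
    (o : EdgeOrientation G) (i : V) (e : G.edgeSet) : ℝ :=
  if o.fst e = i then 1 else if o.snd e = i then -1 else 0

/-! ### Diffusively-coupled networks -/

/-- The fixed data of the network: the agents and the oriented interaction graph `G`.
Spanning subgraphs of `G` are encoded by their edge sets `H : Finset G.edgeSet`. -/
structure Plant {V : Type*} (G : SimpleGraph V) where
  agent : V → Agent
  orient : EdgeOrientation G

/-- An interaction protocol `(Π, w)`: a controller and a constant bias on every edge of `G`. -/
structure Protocol {V : Type*} (G : SimpleGraph V) where
  ctrl : G.edgeSet → SISO
  bias : G.edgeSet → ℝ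

section Network

variable {V : Type*} {G : SimpleGraph V}

/-- States of all the agents. -/
abbrev Plant.AgentState (N : Plant G) : Type _ := ∀ i : V, StateSpace (N.agent i).dim

/-- States of all the edge controllers. -/
abbrev Protocol.CtrlState (p : Protocol G) : Type _ := ∀ e : G.edgeSet, StateSpace (p.ctrl e).dim

/-- The output `y = h(x)`. -/
def Plant.output (N : Plant G) (x : N.AgentState) : V → ℝ := fun i => (N.agent i).h (x i)

/-- `(ℰᵀ y)_e`. -/
def Plant.relOutput (N : Plant G) (y : V → ℝ) (e : G.edgeSet) : ℝ :=
  y (N.orient.fst e) - y (N.orient.snd e)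

/-- `(ℰ_H P_H v)_i`, for `v` indexed by the edges of `G`. -/
def Plant.inject [DecidableEq V] (N : Plant G) (H : Finset G.edgeSet) (v : G.edgeSet → ℝ)
    (i : V) : ℝ :=
  ∑ e ∈ H, N.orient.incidence i e * v e

/-- The controller output `μ_e = ψ_e(η_e, ζ_e)` with `ζ = ℰᵀ h(x)`. -/
def Plant.ctrlOutput (N : Plant G) (p : Protocol G) (x : N.AgentState) (η : p.CtrlState)
    (e : G.edgeSet) : ℝ :=
  (p.ctrl e).h (η e) (N.relOutput (N.output x) e)

/-- The control input `u = -ℰ_H (μ + P_H w)`. -/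
def Plant.input [DecidableEq V] (N : Plant G) (p : Protocol G) (H : Finset G.edgeSet)
    (x : N.AgentState) (η : p.CtrlState) (i : V) : ℝ :=
  -N.inject H (fun e => N.ctrlOutput p x η e + p.bias e) i

/-- `(x, η)` is a closed-loop trajectory on the time interval `I` when protocol `p` is used and the
functioning edges at time `t` are `σ t`. The differential equations hold at every interior time
of `I` at which `σ` does not switch, and trajectories are continuous through the switches.
The controller of an edge that does not function is unconstrained. -/
def Plant.IsTrajectoryOn [DecidableEq V] (N : Plant G) (p : Protocol G)
    (σ : ℝ → Finset G.edgeSet) (I : Set ℝ) (x : ℝ → N.AgentState) (η : ℝ → p.CtrlState) : Prop :=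
  ContinuousOn x I ∧
  (∀ e, ContinuousOn (fun t => η t e) {t | t ∈ I ∧ e ∈ σ t}) ∧
  ∀ t ∈ interior I, (∀ᶠ s in 𝓝 t, σ s = σ t) →
    (∀ i, HasDerivAt (fun s => x s i) ((N.agent i).f (x t i) (N.input p (σ t) (x t) (η t) i)) t) ∧
    ∀ e ∈ σ t,
      HasDerivAt (fun s => η s e) ((p.ctrl e).f (η t e) (N.relOutput (N.output (x t)) e)) t

/-- The output of the network with the fixed graph `H` and protocol `p` converges to `ybar`,
from every initial condition. -/
def Plant.ConvergesTo [DecidableEq V] (N : Plant G) (p : Protocol G) (H : Finset G.edgeSet)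
    (ybar : V → ℝ) : Prop :=
  ∀ (x : ℝ → N.AgentState) (η : ℝ → p.CtrlState),
    N.IsTrajectoryOn p (fun _ => H) (Set.Ici 0) x η →
      Tendsto (fun t => N.output (x t)) atTop (𝓝 ybar)

/-- `y` is a closed-loop steady-state output of the network with graph `H` and protocol `p`:
`y ∈ k(u)`, `ζ = ℰ_Hᵀ y`, `μ ∈ γ(ζ)`, `u = -ℰ_H (μ + P_H w)`. -/
def Plant.IsSteadyOutput [DecidableEq V] (N : Plant G) (p : Protocol G) (H : Finset G.edgeSet)
    (y : V → ℝ) : Prop :=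
  ∃ (u : V → ℝ) (μ : G.edgeSet → ℝ),
    (∀ i, (u i, y i) ∈ (N.agent i).toSISO.rel) ∧
    (∀ e ∈ H, (N.relOutput y e, μ e) ∈ (p.ctrl e).rel) ∧
    ∀ i, u i = -N.inject H (fun e => μ e + p.bias e) i

/-- `kᵢ⁻¹` is a `C¹` function on `ℝ` with positive derivative. -/
def Plant.HasSmoothInverseRel (N : Plant G) : Prop :=
  ∀ i, ∃ κ : ℝ → ℝ, ContDiff ℝ 1 κ ∧ (∀ y, 0 < deriv κ y) ∧
    ∀ u y, (u, y) ∈ (N.agent i).toSISO.rel ↔ u = κ y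

/-- All agents are output-strictly MEIP. -/
def Plant.StrictAgents (N : Plant G) : Prop :=
  ∀ i, (N.agent i).toSISO.IsOutputStrictlyMEIP

/-- All agents are MEIP, and their states are scalar. -/
def Plant.PassiveAgents (N : Plant G) : Prop :=
  ∀ i, (N.agent i).toSISO.IsMEIP ∧ (N.agent i).dim ≤ 1

/-- The part of the standing assumption that concerns the agents alone. -/
def Plant.AgentAssumption (N : Plant G) : Prop :=
  (N.PassiveAgents ∨ N.StrictAgents) ∧ N.HasSmoothInverseRel

/-- The standing assumption on agents and controllers: the agents are MEIP and the controllers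
output-strictly MEIP, or vice versa; `kᵢ⁻¹` and `γ_e` are `C¹` functions, and `kᵢ⁻¹` has positive
derivative. -/
def Plant.StandingAssumption (N : Plant G) (ctrl : G.edgeSet → SISO) : Prop :=
  ((N.PassiveAgents ∧ ∀ e, (ctrl e).IsOutputStrictlyMEIP) ∨
    (N.StrictAgents ∧ ∀ e, (ctrl e).IsMEIP)) ∧
  N.HasSmoothInverseRel ∧
  ∀ e, ∃ g : ℝ → ℝ, ContDiff ℝ 1 g ∧ ∀ ζ μ, (ζ, μ) ∈ (ctrl e).rel ↔ μ = g ζ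

/-! ### Convergence assertion algorithms -/

/-- A (candidate) convergence assertion algorithm. Input: the model, i.e. the graph `H` and the
protocol `p` (the agents are fixed), the conjectured limit, and the states measured in-run from
the moment at which the instance is started. Value: the time, counted from that
moment, at which it stops and declares "no" (`⊤` if it runs indefinitely). -/
abbrev Assertion (N : Plant G) : Type _ :=
  Finset G.edgeSet → (p : Protocol G) → (V → ℝ) → (ℝ → N.AgentState × p.CtrlState) → ℝ≥0∞

/-- Convergence assertion algorithms, on all networks that satisfy the standing assumption.
* It is an on-line algorithm: what it does until time `t` depends on the measurements until `t`.
* No false positives: if the modelled network converges to the conjectured limit, and it is this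
  network that has been measured until time `t`, then it has not declared "no" until `t`.
* No false negatives: if the measured output does not converge to the conjectured limit,
  whatever edges fault during the run, then it declares "no" at some time. -/
structure IsConvergenceAssertion [DecidableEq V] (N : Plant G) (A : Assertion N) : Prop where
  online : ∀ (H : Finset G.edgeSet) (p : Protocol G) (ybar : V → ℝ)
    (z z' : ℝ → N.AgentState × p.CtrlState) (t : ℝ), 0 ≤ t → (∀ s ∈ Set.Icc 0 t, z s = z' s) →
      A H p ybar z ≤ ENNReal.ofReal t → A H p ybar z' = A H p ybar z
  no_false_positive : ∀ (H : Finset G.edgeSet) (p : Protocol G) (ybar : V → ℝ)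
    (x : ℝ → N.AgentState) (η : ℝ → p.CtrlState) (t : ℝ), N.StandingAssumption p.ctrl → 0 ≤ t →
      N.ConvergesTo p H ybar → N.IsTrajectoryOn p (fun _ => H) (Set.Icc 0 t) x η →
        ENNReal.ofReal t < A H p ybar (fun s => (x s, η s))
  no_false_negative : ∀ (H : Finset G.edgeSet) (p : Protocol G) (ybar : V → ℝ)
    (σ : ℝ → Finset G.edgeSet) (x : ℝ → N.AgentState) (η : ℝ → p.CtrlState),
      N.StandingAssumption p.ctrl → AntitoneOn σ (Set.Ici 0) →
      N.IsTrajectoryOn p σ (Set.Ici 0) x η →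
      ¬ Tendsto (fun t => N.output (x t)) atTop (𝓝 ybar) →
        A H p ybar (fun s => (x s, η s)) ≠ ⊤

/-! ### The synthesis algorithm -/

/-- The array `Graphs`: the graphs obtained from `G` by the removal of at most `r` edges. -/
abbrev FaultyGraph (G : SimpleGraph V) [Fintype G.edgeSet] [DecidableEq G.edgeSet] (r : ℕ) : Type _ :=
  {H : Finset G.edgeSet // Hᶜ.card ≤ r}

/-- The faultless graph `G`. -/
def FaultyGraph.full (G : SimpleGraph V) [Fintype G.edgeSet] [DecidableEq G.edgeSet] (r : ℕ) :
    FaultyGraph G r :=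
  ⟨Finset.univ, by simp⟩

/-- The space `ker (ℰ_H P_H)`. -/
def Plant.cycleSpace [DecidableEq V] (N : Plant G) (H : Finset G.edgeSet) :
    Submodule ℝ (G.edgeSet → ℝ) where
  carrier := {w | ∀ i, N.inject H w i = 0}
  zero_mem' := by intro i; simp [Plant.inject]
  add_mem' := by
    intro a b ha hb i
    have h : N.inject H (a + b) i = N.inject H a i + N.inject H b i := by
      simp [Plant.inject, mul_add, Finset.sum_add_distrib]
    rw [h, ha i, hb i, add_zero]
  smul_mem' := by
    intro c a ha i
    have h : N.inject H (c • a) i = c * N.inject H a i := by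
      simp only [Plant.inject, Pi.smul_apply, smul_eq_mul, Finset.mul_sum]
      exact Finset.sum_congr rfl fun e _ => by ring
    rw [h, ha i, mul_zero]

/-- The controllers solve the synthesis problem with graph `H` and goal `y⋆`: they satisfy the
standing assumption and force the network to converge to the steady-state output `y⋆`. -/
def Plant.SolvesSynthesis [DecidableEq V] (N : Plant G) (H : Finset G.edgeSet) (ystar : V → ℝ)
    (ctrl : G.edgeSet → SISO) : Prop :=
  N.StandingAssumption ctrl ∧ N.IsSteadyOutput ⟨ctrl, 0⟩ H ystar ∧ N.ConvergesTo ⟨ctrl, 0⟩ H ystar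

/-- The non-random choices of the synthesis algorithm: the controllers of the exploratory phase,
and for every graph in `Graphs` the controllers of the stable phase and a basis of `ker (ℰ_H P_H)`. -/
structure SynthesisChoice [DecidableEq V] (N : Plant G) [Fintype G.edgeSet]
    [DecidableEq G.edgeSet] (r : ℕ) where
  exploreCtrl : G.edgeSet → SISO
  stableCtrl : FaultyGraph G r → G.edgeSet → SISO
  basisDim : FaultyGraph G r → ℕ
  basis : ∀ j : FaultyGraph G r, Module.Basis (Fin (basisDim j)) ℝ (N.cycleSpace j.1)

/-- The choices meet the requirements of the synthesis algorithm: the exploratory controllers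
satisfy the standing assumption and, for every bias and every graph in `Graphs`, the steady state
that the algorithm has to compute exists; the stable-phase controllers solve the synthesis
problem. -/
structure SynthesisChoice.IsValid [DecidableEq V] {N : Plant G} [Fintype G.edgeSet]
    [DecidableEq G.edgeSet] {r : ℕ} (c : SynthesisChoice N r) (ystar : V → ℝ) : Prop where
  explore_assumption : N.StandingAssumption c.exploreCtrl
  explore_steady : ∀ (w : G.edgeSet → ℝ) (j : FaultyGraph G r),
    ∃ y, N.IsSteadyOutput ⟨c.exploreCtrl, w⟩ j.1 y
  stable_synthesis : ∀ j : FaultyGraph G r, N.SolvesSynthesis j.1 ystar (c.stableCtrl j)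

/-- The result of the synthesis algorithm: the exploratory protocol `(Π, w)` and the arrays `IP` and
`SSLimits`. -/
structure SynthesisOutput (G : SimpleGraph V) [Fintype G.edgeSet] [DecidableEq G.edgeSet]
    (r : ℕ) where
  explore : Protocol G
  IP : FaultyGraph G r → Protocol G
  SSLimits : FaultyGraph G r → V → ℝ

/-- The result of the synthesis algorithm for the random vectors `w` and `α`. -/
def SynthesisChoice.toOutput [DecidableEq V] {N : Plant G} [Fintype G.edgeSet]
    [DecidableEq G.edgeSet] {r : ℕ} (c : SynthesisChoice N r) (w : G.edgeSet → ℝ)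
    (α : ∀ j : FaultyGraph G r, Fin (c.basisDim j) → ℝ) (lim : FaultyGraph G r → V → ℝ) :
    SynthesisOutput G r where
  explore := ⟨c.exploreCtrl, w⟩
  IP := fun j => ⟨c.stableCtrl j, ∑ a, α j a • (c.basis j a : G.edgeSet → ℝ)⟩
  SSLimits := lim

/-! ### The in-run protocol -/

section InRun

variable [Fintype G.edgeSet] [DecidableEq G.edgeSet] {r : ℕ}

/-- The phases of the in-run protocol: the stable phase with an assumed graph, and the exploratory
phase. -/
inductive Phase (G : SimpleGraph V) [Fintype G.edgeSet] [DecidableEq G.edgeSet] (r : ℕ) : Type _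
  | stable (j : FaultyGraph G r)
  | explore

/-- The interaction protocol that the agents run in a phase. -/
def SynthesisOutput.protocol (d : SynthesisOutput G r) : Phase G r → Protocol G
  | .stable j => d.IP j
  | .explore => d.explore

/-- The time at which the `j`-th instance of the exploratory phase declares "no". -/
def exploreTime (N : Plant G) (A : Assertion N) (d : SynthesisOutput G r)
    (z : ℝ → N.AgentState × d.explore.CtrlState) (j : FaultyGraph G r) : ℝ≥0∞ :=
  A j.1 d.explore (d.SSLimits j) z

/-- The time at which the loop of the exploratory phase is left: the first time at which at most one
instance has not declared "no". -/
def exploreDuration (N : Plant G) (A : Assertion N) (d : SynthesisOutput G r)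
    (z : ℝ → N.AgentState × d.explore.CtrlState) : ℝ≥0∞ :=
  sInf {t : ℝ≥0∞ | {j : FaultyGraph G r | t < exploreTime N A d z j}.Subsingleton}

/-- The duration of a phase in which the states `z` are measured. The stable phase with assumed
graph `H` lasts until the convergence assertion algorithm for `H`, `IP` and `y⋆` declares "no". -/
def phaseDuration (N : Plant G) (A : Assertion N) (d : SynthesisOutput G r) (ystar : V → ℝ) :
    (m : Phase G r) → (ℝ → N.AgentState × (d.protocol m).CtrlState) → ℝ≥0∞
  | .stable j, z => A j.1 (d.IP j) ystar z
  | .explore, z => exploreDuration N A d z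

/-- `m'` is the phase that follows the phase `m`. A stable phase is followed by the
exploratory phase. When the loop of the exploratory phase is left, it is restarted if all instances
have declared "no"; otherwise the stable phase starts with the graph of the remaining
instance. -/
def IsNextPhase (N : Plant G) (A : Assertion N) (d : SynthesisOutput G r) :
    (m : Phase G r) → (ℝ → N.AgentState × (d.protocol m).CtrlState) → Phase G r → Prop
  | .stable _, _, m' => m' = .explore
  | .explore, z, m' =>
      (m' = .explore ∧ ∀ j, exploreTime N A d z j ≤ exploreDuration N A d z) ∨
      ∃ j, m' = .stable j ∧ exploreDuration N A d z < exploreTime N A d z j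

/-- A run of the closed loop under the in-run protocol, with switching signal `ς`. The `n`-th phase is
`phase n` and starts at time `start n` (`⊤` if there is no `n`-th phase); `x` is the trajectory of the
agents, and `η n` is the trajectory of the controllers during the `n`-th phase, in time counted
from its start. -/
structure InRun [DecidableEq V] (N : Plant G) (A : Assertion N) (d : SynthesisOutput G r)
    (ystar : V → ℝ) (ς : ℝ → Finset G.edgeSet) where
  x : ℝ → N.AgentState
  phase : ℕ → Phase G r
  start : ℕ → ℝ≥0∞
  η : ∀ n : ℕ, ℝ → (d.protocol (phase n)).CtrlState
  /-- The measurements during the `n`-th phase. -/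
  meas : ∀ n : ℕ, ℝ → N.AgentState × (d.protocol (phase n)).CtrlState
  meas_eq : ∀ n s, meas n s = (x ((start n).toReal + s), η n s)
  start_zero : start 0 = 0
  phase_zero : phase 0 = .stable (FaultyGraph.full G r)
  start_succ : ∀ n, start (n + 1) = start n + phaseDuration N A d ystar (phase n) (meas n)
  phase_succ : ∀ n, start (n + 1) ≠ ⊤ → IsNextPhase N A d (phase n) (meas n) (phase (n + 1))
  trajectory : ∀ n, start n ≠ ⊤ →
    N.IsTrajectoryOn (d.protocol (phase n)) (fun s => ς ((start n).toReal + s))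
      {s | 0 ≤ s ∧ ENNReal.ofReal s ≤ phaseDuration N A d ystar (phase n) (meas n)}
      (fun s => x ((start n).toReal + s)) (η n)

end InRun

end Network

end NetworkFDI

end

/-!
The in-run protocol never needs to know the faulty edges in advance: an endless stable phase already
means that the output converges to `y⋆`, because an assertion algorithm that never declares "no"
certifies the limit. So the point is that every run has an endless phase and that this phase is not
exploratory. Three facts give this.

* *Passive networks converge* (`Plant.convergesTo_of_isSteadyOutput`). If a steady-state output exists,
  then the sum of the storage functions at the steady state is dissipated by the output-strict systems.
  Barbalat's lemma (`tendsto_of_dissipation`) settles the case of output-strict agents. In the other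
  case it makes the agents' inputs converge, and then a scalar agent can only accumulate at equilibria
  (`equilibrium_of_mapClusterPt`), all of which have the same output as `κ = k⁻¹` is injective.
* *Generic biases separate the faulty graphs* (`Plant.volume_common_steadyOutput`). The biases for which
  two different graphs share a steady-state output form the image of a subset of a proper subspace
  under a differentiable self-map of `ℝ^𝔼`, hence a null set.
* *Runs* (`InRun.tendsto_output`). The functioning graphs at the starts of the phases decrease, so they
  are eventually equal to one graph `j₀`. From then on the instance of the assertion algorithm for `j₀`
  watches exactly the network that it models, which converges to the limit that it tests. So it never
  stops: the exploratory phase can only select `j₀`, and the stable phase `j₀` is endless. This excludes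
  infinitely many phases, also in finite time. An endless exploratory phase would have two different
  limits of the output.

Valid choices exist with static controllers (`exists_isValid_synthesisChoice`). The steady-state output
minimizes a convex potential, which is coercive after the reference inputs `κ(y⋆)` have been produced by
edge flows; that is possible since `k`-connected graphs stay connected when `k - 2` edges are removed
(`IsKConnected.rel_of_edges`).
-/

namespace NetworkFDI

/-! ### Dissipation and drift of scalar signals -/

/-- A form of Barbalat's lemma: a nonnegative quantity that is dissipated at a rate of at least
`ρ (q - L)²` forces the uniformly continuous signal `q` to converge to `L`. -/
theorem tendsto_of_dissipation {W W' q : ℝ → ℝ} {ρ L : ℝ} (hρ : 0 < ρ)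
    (hW : ∀ t, 1 ≤ t → HasDerivAt W (W' t) t) (hd : ∀ t, 1 ≤ t → W' t ≤ -ρ * (q t - L) ^ 2)
    (hnn : ∀ t, 1 ≤ t → 0 ≤ W t) (hq : UniformContinuousOn q (Set.Ici 1)) :
    Tendsto q atTop (𝓝 L) := by
  have hdrop : ∀ C a b : ℝ, 1 ≤ a → a ≤ b → (∀ t ∈ Set.Icc a b, W' t ≤ C) →
      W b - W a ≤ C * (b - a) := by
    intro C a b ha hab hC
    refine (convex_Icc a b).image_sub_le_mul_sub_of_deriv_le
      (fun t ht => (hW t (ha.trans ht.1)).continuousAt.continuousWithinAt)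
      (fun t ht => ?_) (fun t ht => ?_) a (Set.left_mem_Icc.2 hab) b (Set.right_mem_Icc.2 hab) hab
    · exact (hW t (ha.trans (interior_subset ht).1)).differentiableAt.differentiableWithinAt
    · rw [(hW t (ha.trans (interior_subset ht).1)).deriv]
      exact hC t (interior_subset ht)
  have hanti : Antitone (fun t => W (max 1 t)) := by
    intro a b hab
    have := hdrop 0 (max 1 a) (max 1 b) (le_max_left _ _) (max_le_max le_rfl hab) (fun t ht => by
      have h1 := hd t ((le_max_left _ _).trans ht.1)
      nlinarith [sq_nonneg (q t - L)])
    simp only at *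
    linarith
  have hlim : ∃ W₀, Tendsto W atTop (𝓝 W₀) := by
    refine ⟨_, (tendsto_atTop_ciInf hanti ⟨0, ?_⟩).congr' ?_⟩
    · rintro _ ⟨t, rfl⟩
      exact hnn _ (le_max_left _ _)
    · filter_upwards [eventually_ge_atTop 1] with t ht
      rw [max_eq_right ht]
  obtain ⟨W₀, hL⟩ := hlim
  rw [Metric.tendsto_atTop]
  intro ε hε
  obtain ⟨δ, hδ, huc⟩ := Metric.uniformContinuousOn_iff.1 hq (ε / 2) (half_pos hε)
  have hshift : Tendsto (fun t => W (t + δ / 2) - W t) atTop (𝓝 0) := by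
    have := (hL.comp (tendsto_atTop_add_const_right atTop (δ / 2) tendsto_id)).sub hL
    simpa using this
  have hpos : 0 < ρ * (ε / 2) ^ 2 * (δ / 2) := by positivity
  obtain ⟨T, hT⟩ := eventually_atTop.1 (hshift.eventually (lt_mem_nhds (neg_lt_zero.2 hpos)))
  refine ⟨max 1 T, fun t ht => ?_⟩
  have ht1 : 1 ≤ t := (le_max_left _ _).trans ht
  by_contra hcon
  rw [Real.dist_eq, not_lt] at hcon
  have hstep := hdrop (-ρ * (ε / 2) ^ 2) t (t + δ / 2) ht1 (by linarith) (fun s hs => by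
    have h1 := huc s (ht1.trans hs.1) t ht1 (by
      rw [Real.dist_eq, abs_of_nonneg (by linarith [hs.1])]
      linarith [hs.2])
    rw [Real.dist_eq] at h1
    have h2 : ε / 2 ≤ |q s - L| := by
      have := abs_sub_le (q t) (q s) L
      rw [abs_sub_comm (q s)] at h1
      linarith
    have h3 : (ε / 2) ^ 2 ≤ (q s - L) ^ 2 := by
      rw [← sq_abs (q s - L)]
      exact pow_le_pow_left₀ (half_pos hε).le h2 2
    nlinarith [hd s (ht1.trans hs.1)])
  have hlast := hT t ((le_max_right _ _).trans ht)
  have : t + δ / 2 - t = δ / 2 := by ring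
  rw [this] at hstep
  linarith

/-- A scalar signal that moves upwards with a uniform speed whenever it is `δ`-close to `c`
eventually stays away from `c`. -/
theorem eventually_far_of_drift {x v : ℝ → ℝ} {c m δ T : ℝ} (hm : 0 < m) (hδ : 0 < δ)
    (hx : ∀ t, T ≤ t → HasDerivAt x (v t) t) (hv : ∀ t, T ≤ t → |x t - c| ≤ δ → m ≤ v t) :
    ∀ᶠ t in atTop, δ / 2 ≤ |x t - c| := by
  by_contra hcon
  simp only [eventually_atTop, not_exists, not_forall, not_le] at hcon
  obtain ⟨t₀, ht₀, h₀⟩ := hcon T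
  rw [abs_lt] at h₀
  have hcont : ∀ a b, T ≤ a → ContinuousOn (fun t => -x t) (Set.Icc a b) := fun a b ha t ht =>
    (hx t (ha.trans ht.1)).continuousAt.neg.continuousWithinAt
  -- The line of slope `m / 2` from `c - δ / 2` to `c + δ` is a lower fence.
  set t₁ := t₀ + 3 * δ / m with ht₁
  have ht01 : t₀ ≤ t₁ := by
    have : 0 < 3 * δ / m := by positivity
    linarith
  have hfence := image_le_of_deriv_right_lt_deriv_boundary (hcont t₀ t₁ ht₀)
    (f' := fun t => -v t) (B := fun t => -(c - δ / 2 + m / 2 * (t - t₀))) (B' := fun _ => -(m / 2))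
    (fun t ht => (hx t (ht₀.trans ht.1)).neg.hasDerivWithinAt) (by simp; linarith [h₀.1])
    (fun t => by
      simpa using ((((hasDerivAt_id t).sub_const t₀).const_mul (m / 2)).const_add (c - δ / 2)).fun_neg)
    (fun t ht h => by
      have h1 : m * (t - t₀) ≤ 3 * δ := by
        have h2 := ht.2.le
        rw [ht₁] at h2
        calc m * (t - t₀) ≤ m * (3 * δ / m) := by gcongr; linarith
          _ = 3 * δ := by field_simp
      have h3 : 0 ≤ m * (t - t₀) := mul_nonneg hm.le (sub_nonneg.2 ht.1)
      have := hv t (ht₀.trans ht.1) (by rw [abs_le]; constructor <;> linarith)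
      linarith)
  have hx₁ : c + δ ≤ x t₁ := by
    have h1 := hfence (Set.right_mem_Icc.2 ht01)
    have h2 : m / 2 * (t₁ - t₀) = 3 * δ / 2 := by rw [ht₁]; field_simp; ring
    simp only [h2] at h1
    linarith
  obtain ⟨t₂, ht₂, h₂⟩ := hcon t₁
  have h3 := image_le_of_deriv_right_lt_deriv_boundary (hcont t₁ t₂ (ht₀.trans ht01))
    (f' := fun t => -v t) (B := fun _ => -(c + δ)) (B' := fun _ => 0)
    (fun t ht => (hx t ((ht₀.trans ht01).trans ht.1)).neg.hasDerivWithinAt) (by linarith)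
    (fun t => hasDerivAt_const t _)
    (fun t ht h => by
      have := hv t ((ht₀.trans ht01).trans ht.1) (by
        rw [show x t - c = δ by linarith, abs_of_pos hδ])
      linarith) (Set.right_mem_Icc.2 ht₂)
  rw [abs_lt] at h₂
  linarith

/-! ### Single systems -/

theorem exists_abs_le_of_mem_compact {α : Type*} [TopologicalSpace α] {h : α → ℝ → ℝ}
    (hh : Continuous (Function.uncurry h)) {K : Set α} (hK : IsCompact K) {z : ℝ → α} {u : ℝ → ℝ}
    (hz : ∀ t, 1 ≤ t → z t ∈ K) (hu : ∃ M, ∀ t, 1 ≤ t → |u t| ≤ M) :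
    ∃ M, ∀ t, 1 ≤ t → |h (z t) (u t)| ≤ M := by
  obtain ⟨M, hM⟩ := hu
  obtain ⟨C, hC⟩ := (hK.prod (isCompact_Icc (a := -M) (b := M))).exists_bound_of_continuousOn
    hh.continuousOn
  exact ⟨C, fun t ht => hC (z t, u t) ⟨hz t ht, abs_le.1 (hM t ht)⟩⟩

theorem uniformContinuousOn_of_bounded_input {n : ℕ} {f : StateSpace n → ℝ → StateSpace n}
    (hf : Continuous (Function.uncurry f)) {K : Set (StateSpace n)} (hK : IsCompact K)
    {z : ℝ → StateSpace n} {u : ℝ → ℝ} (hz : ∀ t, 1 ≤ t → z t ∈ K)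
    (hu : ∃ M, ∀ t, 1 ≤ t → |u t| ≤ M) (hd : ∀ t, 1 ≤ t → HasDerivAt z (f (z t) (u t)) t) :
    UniformContinuousOn z (Set.Ici 1) := by
  obtain ⟨M, hM⟩ := hu
  obtain ⟨C, hC⟩ := (hK.prod (isCompact_Icc (a := -M) (b := M))).exists_bound_of_continuousOn
    hf.continuousOn
  refine ((convex_Ici (1 : ℝ)).lipschitzOnWith_of_nnnorm_hasDerivWithin_le (C := C.toNNReal)
    (fun t ht => (hd t ht).hasDerivWithinAt) (fun t ht => ?_)).uniformContinuousOn
  rw [← NNReal.coe_le_coe, coe_nnnorm]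
  exact (hC (z t, u t) ⟨hz t ht, abs_le.1 (hM t ht)⟩).trans (Real.le_coe_toNNReal C)

/-- Along a scalar (or trivial) state driven by an input that converges to `ū`, every cluster point
of the state is an equilibrium for the input `ū`. -/
theorem equilibrium_of_mapClusterPt {n : ℕ} (hn : n ≤ 1) {f : StateSpace n → ℝ → StateSpace n}
    (hf : Continuous (Function.uncurry f)) {z : ℝ → StateSpace n} {u : ℝ → ℝ} {ubar : ℝ}
    (hz : ∀ t, 1 ≤ t → HasDerivAt z (f (z t) (u t)) t) (hu : Tendsto u atTop (𝓝 ubar))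
    {c : StateSpace n} (hc : MapClusterPt c atTop z) : f c ubar = 0 := by
  by_contra hne
  obtain ⟨j, hj⟩ : ∃ j, f c ubar j ≠ 0 := by
    by_contra! h
    exact hne (by ext j; simpa using h j)
  obtain rfl : n = 1 := le_antisymm hn (Nat.succ_le_of_lt (Fin.pos j))
  -- After a change of sign the drift at `c` is upwards.
  obtain ⟨s, hs1, hpos⟩ : ∃ s : ℝ, |s| = 1 ∧ 0 < s * f c ubar j := by
    rcases lt_or_gt_of_ne hj with h | h
    · exact ⟨-1, by simp, by linarith⟩
    · exact ⟨1, by simp, by linarith⟩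
  have hcont : Continuous fun p : StateSpace 1 × ℝ => s * f p.1 p.2 j := by
    have : Continuous fun p : StateSpace 1 × ℝ => (Function.uncurry f p) j := by fun_prop
    exact continuous_const.mul this
  have hnear : ∀ᶠ p in 𝓝 (c, ubar), s * f c ubar j / 2 < s * f p.1 p.2 j :=
    hcont.continuousAt.eventually (lt_mem_nhds (by simp only; linarith))
  obtain ⟨δ, hδ, hball⟩ := Metric.nhds_basis_closedBall.eventually_iff.1 hnear
  have hdist : ∀ c' : StateSpace 1, dist c' c = |s * c' j - s * c j| := by
    intro c'
    rw [← mul_sub, abs_mul, hs1, one_mul, EuclideanSpace.dist_eq, Fin.sum_univ_one,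
      Subsingleton.elim j 0, Real.dist_eq, Real.sqrt_sq (abs_nonneg _)]
  obtain ⟨T, hT⟩ := eventually_atTop.1 (hu.eventually (Metric.closedBall_mem_nhds ubar hδ))
  have hfar := eventually_far_of_drift (x := fun t => s * z t j) (v := fun t => s * f (z t) (u t) j)
    (c := s * c j) (T := max 1 T) (half_pos hpos) hδ
    (fun t ht => ((EuclideanSpace.proj (𝕜 := ℝ) j).hasFDerivAt.comp_hasDerivAt t
      (hz t ((le_max_left _ _).trans ht))).const_mul s)
    (fun t ht h => (hball (x := (z t, u t)) (by
      rw [← closedBall_prod_same]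
      exact ⟨by rwa [Metric.mem_closedBall, hdist], hT t ((le_max_right _ _).trans ht)⟩)).le)
  obtain ⟨t, h1, h2⟩ :=
    ((hc.frequently (Metric.ball_mem_nhds c (half_pos hδ))).and_eventually hfar).exists
  rw [← hdist] at h2
  exact absurd h1 (not_lt.2 h2)

theorem tendsto_output_of_scalar {n : ℕ} (hn : n ≤ 1) {f : StateSpace n → ℝ → StateSpace n}
    (hf : Continuous (Function.uncurry f)) {h : StateSpace n → ℝ} (hh : Continuous h)
    {z : ℝ → StateSpace n} {u : ℝ → ℝ} {ubar ybar : ℝ} {K : Set (StateSpace n)} (hK : IsCompact K)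
    (hzK : ∀ t, 1 ≤ t → z t ∈ K) (hz : ∀ t, 1 ≤ t → HasDerivAt z (f (z t) (u t)) t)
    (hu : Tendsto u atTop (𝓝 ubar)) (heq : ∀ c, f c ubar = 0 → h c = ybar) :
    Tendsto (fun t => h (z t)) atTop (𝓝 ybar) := by
  rw [Metric.tendsto_nhds]
  intro ε hε
  by_contra hcon
  have hclosed : IsClosed {c | ε ≤ dist (h c) ybar} :=
    isClosed_le continuous_const (hh.dist continuous_const)
  have hfreq : ∃ᶠ t in atTop, z t ∈ K ∩ {c | ε ≤ dist (h c) ybar} := by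
    rw [not_eventually] at hcon
    refine (hcon.and_eventually (eventually_ge_atTop 1)).mono fun t ht => ?_
    exact ⟨hzK t ht.2, not_lt.1 ht.1⟩
  obtain ⟨c, hcK, hc⟩ := (hK.inter_right hclosed).exists_mapClusterPt_of_frequently hfreq
  have h1 := heq c (equilibrium_of_mapClusterPt hn hf hz hu hc)
  have h2 : ε ≤ dist (h c) ybar := hcK.2
  rw [h1, dist_self] at h2
  linarith

/-! ### Convergence of passive networks -/

section Network

variable {V : Type*} {G : SimpleGraph V}

theorem EdgeOrientation.fst_ne_snd (o : EdgeOrientation G) (e : G.edgeSet) : o.fst e ≠ o.snd e := by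
  intro h
  have h1 : s(o.fst e, o.snd e) ∈ G.edgeSet := by rw [o.spec e]; exact e.2
  rw [SimpleGraph.mem_edgeSet, h] at h1
  exact G.irrefl h1

variable [DecidableEq V]

theorem EdgeOrientation.incidence_eq (o : EdgeOrientation G) (i : V) (e : G.edgeSet) :
    o.incidence i e = (if o.fst e = i then 1 else 0) - if o.snd e = i then 1 else 0 := by
  have := o.fst_ne_snd e
  unfold EdgeOrientation.incidence
  split_ifs with h1 h2 <;> simp_all

variable [Fintype V]

/-- `ℰ_H P_H` and `P_H ℰᵀ` are adjoint to each other. -/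
theorem Plant.sum_mul_inject (N : Plant G) (H : Finset G.edgeSet) (y : V → ℝ) (v : G.edgeSet → ℝ) :
    ∑ i, y i * N.inject H v i = ∑ e ∈ H, v e * N.relOutput y e := by
  simp only [Plant.inject, Finset.mul_sum]
  rw [Finset.sum_comm]
  refine Finset.sum_congr rfl fun e _ => ?_
  simp only [EdgeOrientation.incidence_eq, Plant.relOutput, sub_mul, mul_sub, ite_mul, one_mul,
    zero_mul, mul_ite, mul_zero, Finset.sum_sub_distrib, Finset.sum_ite_eq, Finset.mem_univ, if_true]
  ring


/-- Relative to a steady state, the supply rates of the agents and of the functioning controllers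
cancel: the feedback through the edges preserves power, whatever the bias. -/
theorem Plant.sum_supply_eq_zero (N : Plant G) (p : Protocol G) (H : Finset G.edgeSet)
    (x : N.AgentState) (η : p.CtrlState) {ubar ybar : V → ℝ} {μbar : G.edgeSet → ℝ}
    (hubar : ∀ i, ubar i = -N.inject H (fun e => μbar e + p.bias e) i) :
    ∑ i, (N.output x i - ybar i) * (N.input p H x η i - ubar i) +
      ∑ e ∈ H, (N.ctrlOutput p x η e - μbar e) *
        (N.relOutput (N.output x) e - N.relOutput ybar e) = 0 := by
  have h1 : ∀ i, N.input p H x η i - ubar i =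
      -N.inject H (fun e => N.ctrlOutput p x η e - μbar e) i := by
    intro i
    rw [hubar i]
    simp only [Plant.input, Plant.inject]
    rw [← sub_eq_zero, ← Finset.sum_neg_distrib, ← Finset.sum_neg_distrib,
      ← Finset.sum_neg_distrib, ← Finset.sum_sub_distrib, ← Finset.sum_sub_distrib]
    exact Finset.sum_eq_zero fun e _ => by ring
  have h2 := N.sum_mul_inject H (fun i => N.output x i - ybar i)
    (fun e => N.ctrlOutput p x η e - μbar e)
  have h3 : ∀ e, N.relOutput (fun i => N.output x i - ybar i) e =
      N.relOutput (N.output x) e - N.relOutput ybar e := fun e => by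
    simp only [Plant.relOutput]; ring
  simp only [h3] at h2
  simp only [h1, mul_neg, Finset.sum_neg_distrib]
  rw [h2, neg_add_cancel]

/-- Passivity of all systems makes every steady-state output globally attractive. With output-strict
agents this is Barbalat's lemma for the agent outputs. With output-strict controllers it is
Barbalat's lemma for the controller outputs; the agents' inputs converge, and scalar agents then
settle at equilibria. -/
theorem Plant.convergesTo_of_isSteadyOutput (N : Plant G) (p : Protocol G) (H : Finset G.edgeSet)
    (hp : N.StandingAssumption p.ctrl) {ybar : V → ℝ} (hy : N.IsSteadyOutput p H ybar) :
    N.ConvergesTo p H ybar := by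
  obtain ⟨ubar, μbar, hag, hct, hubar⟩ := hy
  obtain ⟨hcase, hsm, -⟩ := hp
  rintro x η ⟨-, -, hode⟩
  have hx : ∀ t, 1 ≤ t → ∀ i, HasDerivAt (fun s => x s i)
      ((N.agent i).f (x t i) (N.input p H (x t) (η t) i)) t := fun t ht =>
    (hode t (by rw [interior_Ici]; exact lt_of_lt_of_le one_pos ht) (by simp)).1
  have hη : ∀ t, 1 ≤ t → ∀ e ∈ H, HasDerivAt (fun s => η s e)
      ((p.ctrl e).f (η t e) (N.relOutput (N.output (x t)) e)) t := fun t ht =>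
    (hode t (by rw [interior_Ici]; exact lt_of_lt_of_le one_pos ht) (by simp)).2
  -- Storage functions and passivity indices, with one of the two sides output-strict.
  obtain ⟨ρ, σ, hρ, hσ, hstrict, hpa, hpc⟩ : ∃ (ρ : V → ℝ) (σ : G.edgeSet → ℝ),
      (∀ i, 0 ≤ ρ i) ∧ (∀ e, 0 ≤ σ e) ∧
      (((∀ e ∈ H, 0 < σ e) ∧ ∀ i, (N.agent i).dim ≤ 1) ∨ ∀ i, 0 < ρ i) ∧
      (∀ i, (N.agent i).toSISO.IsPassiveAt (ubar i) (ybar i) (ρ i)) ∧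
      ∀ e ∈ H, (p.ctrl e).IsPassiveAt (N.relOutput ybar e) (μbar e) (σ e) := by
    rcases hcase with ⟨ha, hc⟩ | ⟨ha, hc⟩
    · choose ρ hρ using fun i => (ha i).1.1 _ (hag i)
      have : ∀ e, ∃ σ : ℝ, 0 ≤ σ ∧ (e ∈ H → 0 < σ ∧
          (p.ctrl e).IsPassiveAt (N.relOutput ybar e) (μbar e) σ) := fun e => by
        by_cases he : e ∈ H
        · obtain ⟨σ, h1, h2⟩ := (hc e).1 _ (hct e he)
          exact ⟨σ, h1.le, fun _ => ⟨h1, h2⟩⟩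
        · exact ⟨0, le_rfl, fun h => absurd h he⟩
      choose σ hσ hσ' using this
      exact ⟨ρ, σ, fun i => (hρ i).1, hσ, Or.inl ⟨fun e he => (hσ' e he).1, fun i => (ha i).2⟩,
        fun i => (hρ i).2, fun e he => (hσ' e he).2⟩
    · choose ρ hρ using fun i => (ha i).1 _ (hag i)
      have : ∀ e, ∃ σ : ℝ, 0 ≤ σ ∧ (e ∈ H →
          (p.ctrl e).IsPassiveAt (N.relOutput ybar e) (μbar e) σ) := fun e => by
        by_cases he : e ∈ H
        · obtain ⟨σ, h1, h2⟩ := (hc e).1 _ (hct e he)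
          exact ⟨σ, h1, fun _ => h2⟩
        · exact ⟨0, le_rfl, fun h => absurd h he⟩
      choose σ hσ hσ' using this
      exact ⟨ρ, σ, fun i => (hρ i).1.le, hσ, Or.inr fun i => (hρ i).1, fun i => (hρ i).2, hσ'⟩
  choose S hS hSd using hpa
  have : ∀ e, ∃ W : StateSpace (p.ctrl e).dim → ℝ, e ∈ H → IsStorage W ∧
      ∀ (z : StateSpace (p.ctrl e).dim) (u : ℝ), fderiv ℝ W z ((p.ctrl e).f z u) ≤
        -σ e * ((p.ctrl e).h z u - μbar e) ^ 2 +
          ((p.ctrl e).h z u - μbar e) * (u - N.relOutput ybar e) := fun e => by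
    by_cases he : e ∈ H
    · obtain ⟨W, h1, h2⟩ := hpc e he
      exact ⟨W, fun _ => ⟨h1, h2⟩⟩
    · exact ⟨0, fun h => absurd h he⟩
  choose W hW using this
  -- The total storage is nonincreasing.
  set T : ℝ → ℝ := fun t => ∑ i, S i (x t i) + ∑ e ∈ H, W e (η t e) with hT
  set D : ℝ → ℝ := fun t =>
    ∑ i, fderiv ℝ (S i) (x t i) ((N.agent i).f (x t i) (N.input p H (x t) (η t) i)) +
    ∑ e ∈ H, fderiv ℝ (W e) (η t e) ((p.ctrl e).f (η t e) (N.relOutput (N.output (x t)) e))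
  have hTd : ∀ t, 1 ≤ t → HasDerivAt T (D t) t := by
    intro t ht
    refine HasDerivAt.add ?_ ?_
    · exact HasDerivAt.fun_sum fun i _ =>
        ((hS i).1 (x t i)).hasFDerivAt.comp_hasDerivAt t (hx t ht i)
    · exact HasDerivAt.fun_sum fun e he =>
        ((hW e he).1.1 (η t e)).hasFDerivAt.comp_hasDerivAt t (hη t ht e he)
  have hDle : ∀ t, D t ≤ -(∑ i, ρ i * (N.output (x t) i - ybar i) ^ 2 +
      ∑ e ∈ H, σ e * (N.ctrlOutput p (x t) (η t) e - μbar e) ^ 2) := by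
    intro t
    have h1 := Finset.sum_le_sum fun i (_ : i ∈ Finset.univ) =>
      hSd i (x t i) (N.input p H (x t) (η t) i)
    have h2 := Finset.sum_le_sum fun e (he : e ∈ H) =>
      (hW e he).2 (η t e) (N.relOutput (N.output (x t)) e)
    have h3 := N.sum_supply_eq_zero p H (x t) (η t) (ybar := ybar) hubar
    rw [Finset.sum_add_distrib] at h1 h2
    simp only [neg_mul, Finset.sum_neg_distrib] at h1 h2
    have h4 := add_le_add h1 h2
    refine h4.trans (le_of_eq ?_)
    simp only [Plant.output, Plant.ctrlOutput, Agent.toSISO] at h3 ⊢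
    linarith
  have hSnn : ∀ t, ∀ i ∈ Finset.univ, 0 ≤ S i (x t i) := fun t i _ => (hS i).2.1 _
  have hWnn : ∀ t, ∀ e ∈ H, 0 ≤ W e (η t e) := fun t e he => (hW e he).1.2.1 _
  have hTnn : ∀ t, 1 ≤ t → 0 ≤ T t := fun t _ =>
    add_nonneg (Finset.sum_nonneg (hSnn t)) (Finset.sum_nonneg (hWnn t))
  have hρnn : ∀ t, ∀ i ∈ Finset.univ, 0 ≤ ρ i * (N.output (x t) i - ybar i) ^ 2 :=
    fun t i _ => mul_nonneg (hρ i) (sq_nonneg _)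
  have hσnn : ∀ t, ∀ e ∈ H, 0 ≤ σ e * (N.ctrlOutput p (x t) (η t) e - μbar e) ^ 2 :=
    fun t e _ => mul_nonneg (hσ e) (sq_nonneg _)
  have hTle : ∀ t, 1 ≤ t → T t ≤ T 1 := by
    intro t ht
    have hanti : AntitoneOn T (Set.Ici 1) := by
      refine antitoneOn_of_deriv_nonpos (convex_Ici 1)
        (fun s hs => (hTd s hs).continuousAt.continuousWithinAt)
        (fun s hs => (hTd s (interior_subset hs)).differentiableAt.differentiableWithinAt)
        fun s hs => ?_
      rw [(hTd s (interior_subset hs)).deriv]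
      linarith [hDle s, Finset.sum_nonneg (hρnn s), Finset.sum_nonneg (hσnn s)]
    exact hanti Set.self_mem_Ici ht ht
  -- All states remain in compact sublevel sets, so that all signals are bounded.
  have hxK : ∀ i t, 1 ≤ t → x t i ∈ {z | S i z ≤ T 1} := fun i t ht => by
    have h1 := Finset.single_le_sum (hSnn t) (Finset.mem_univ i)
    have h2 := Finset.sum_nonneg (hWnn t)
    have h3 : ∑ i, S i (x t i) + ∑ e ∈ H, W e (η t e) ≤ T 1 := hTle t ht
    change S i (x t i) ≤ T 1
    linarith
  have hηK : ∀ e ∈ H, ∀ t, 1 ≤ t → η t e ∈ {z | W e z ≤ T 1} := fun e he t ht => by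
    have h1 := Finset.single_le_sum (hWnn t) he
    have h2 := Finset.sum_nonneg (hSnn t)
    have h3 : ∑ i, S i (x t i) + ∑ e ∈ H, W e (η t e) ≤ T 1 := hTle t ht
    change W e (η t e) ≤ T 1
    linarith
  have hζB : ∀ e, ∃ M, ∀ t, 1 ≤ t → |N.relOutput (N.output (x t)) e| ≤ M := by
    intro e
    have hyB : ∀ i, ∃ M, ∀ t, 1 ≤ t → |N.output (x t) i| ≤ M := fun i =>
      exists_abs_le_of_mem_compact (h := (N.agent i).toSISO.h) (N.agent i).toSISO.continuous_h
        ((hS i).2.2 (T 1)) (hxK i) ⟨0, fun t _ => (abs_zero (α := ℝ)).le⟩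
    obtain ⟨M₁, h₁⟩ := hyB (N.orient.fst e)
    obtain ⟨M₂, h₂⟩ := hyB (N.orient.snd e)
    exact ⟨M₁ + M₂, fun t ht => (abs_sub _ _).trans (add_le_add (h₁ t ht) (h₂ t ht))⟩
  have hμB : ∀ e, ∃ M, e ∈ H → ∀ t, 1 ≤ t → |N.ctrlOutput p (x t) (η t) e| ≤ M := by
    intro e
    by_cases he : e ∈ H
    · obtain ⟨M, hM⟩ := exists_abs_le_of_mem_compact (p.ctrl e).continuous_h
        ((hW e he).1.2.2 (T 1)) (hηK e he) (hζB e)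
      exact ⟨M, fun _ => hM⟩
    · exact ⟨0, fun h => absurd h he⟩
  choose M hM using hμB
  have huB : ∀ i, ∃ B, ∀ t, 1 ≤ t → |N.input p H (x t) (η t) i| ≤ B := by
    intro i
    refine ⟨∑ e ∈ H, |N.orient.incidence i e| * (M e + |p.bias e|), fun t ht => ?_⟩
    rw [Plant.input, abs_neg]
    refine (Finset.abs_sum_le_sum_abs _ _).trans (Finset.sum_le_sum fun e he => ?_)
    rw [abs_mul]
    exact mul_le_mul_of_nonneg_left
      ((abs_add_le _ _).trans (add_le_add_left (hM e he t ht) _)) (abs_nonneg _)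
  -- Bounded velocities make the outputs uniformly continuous.
  have hxuc : ∀ i, UniformContinuousOn (fun t => x t i) (Set.Ici 1) := fun i =>
    uniformContinuousOn_of_bounded_input (N.agent i).continuous_f ((hS i).2.2 (T 1)) (hxK i) (huB i)
      fun t ht => hx t ht i
  have hyuc : ∀ i, UniformContinuousOn (fun t => N.output (x t) i) (Set.Ici 1) := fun i =>
    (((hS i).2.2 (T 1)).uniformContinuousOn_of_continuous
      (N.agent i).continuous_h.continuousOn).comp (hxuc i) (hxK i)
  rw [tendsto_pi_nhds]
  intro i
  rcases hstrict with ⟨hσpos, hdim⟩ | hρpos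
  · have hμ : ∀ e ∈ H, Tendsto (fun t => N.ctrlOutput p (x t) (η t) e) atTop (𝓝 (μbar e)) := by
      intro e he
      have hζuc : UniformContinuousOn (fun t => N.relOutput (N.output (x t)) e) (Set.Ici 1) :=
        uniformContinuousOn_iff_restrict.2
          ((uniformContinuousOn_iff_restrict.1 (hyuc _)).sub
            (uniformContinuousOn_iff_restrict.1 (hyuc _)))
      have hηuc : UniformContinuousOn (fun t => η t e) (Set.Ici 1) :=
        uniformContinuousOn_of_bounded_input (p.ctrl e).continuous_f ((hW e he).1.2.2 (T 1))
          (hηK e he) (hζB e) fun t ht => hη t ht e he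
      obtain ⟨B, hB⟩ := hζB e
      have hpuc : UniformContinuousOn (fun t => (η t e, N.relOutput (N.output (x t)) e))
          (Set.Ici 1) := uniformContinuousOn_iff_restrict.2
        ((uniformContinuousOn_iff_restrict.1 hηuc).prodMk
          (uniformContinuousOn_iff_restrict.1 hζuc))
      have hμuc : UniformContinuousOn (fun t => N.ctrlOutput p (x t) (η t) e) (Set.Ici 1) :=
        ((((hW e he).1.2.2 (T 1)).prod
          (isCompact_Icc (a := -B) (b := B))).uniformContinuousOn_of_continuous
          (p.ctrl e).continuous_h.continuousOn).comp hpuc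
          fun t ht => ⟨hηK e he t ht, abs_le.1 (hB t ht)⟩
      exact tendsto_of_dissipation (hσpos e he) hTd (fun t _ => by
        have h1 := Finset.single_le_sum (hσnn t) he
        linarith [hDle t, Finset.sum_nonneg (hρnn t)]) hTnn hμuc
    have hu : Tendsto (fun t => N.input p H (x t) (η t) i) atTop (𝓝 (ubar i)) := by
      rw [hubar i]
      exact (tendsto_finsetSum _ fun e he => ((hμ e he).add_const _).const_mul _).neg
    refine tendsto_output_of_scalar (hdim i) (N.agent i).continuous_f (N.agent i).continuous_h
      ((hS i).2.2 (T 1)) (hxK i) (fun t ht => hx t ht i) hu fun c hc => ?_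
    obtain ⟨κ, hκ, hκ', hrel⟩ := hsm i
    have h1 := (hrel _ _).1 (hag i)
    have h2 := (hrel _ _).1 ⟨c, hc, rfl⟩
    exact (strictMono_of_deriv_pos hκ').injective (h2.symm.trans h1)
  · exact tendsto_of_dissipation (hρpos i) hTd (fun t _ => by
        have h1 := Finset.single_le_sum (hρnn t) (Finset.mem_univ i)
        linarith [hDle t, Finset.sum_nonneg (hσnn t)]) hTnn (hyuc i)

end Network

/-! ### Generic biases separate the faulty graphs -/

theorem differentiableAt_invFun {κ : ℝ → ℝ} (hκ : ContDiff ℝ 1 κ) (hpos : ∀ y, 0 < deriv κ y)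
    (y : ℝ) : DifferentiableAt ℝ (Function.invFun κ) (κ y) := by
  have hs : HasStrictDerivAt κ (deriv κ y) y := hκ.contDiffAt.hasStrictDerivAt one_ne_zero
  exact (hs.to_local_left_inverse (hpos y).ne' (Eventually.of_forall
    (Function.leftInverse_invFun (strictMono_of_deriv_pos hpos).injective))).hasDerivAt.differentiableAt

section Network

variable {V : Type*} {G : SimpleGraph V} [DecidableEq V]

theorem Plant.inject_single (N : Plant G) [DecidableEq G.edgeSet] (H : Finset G.edgeSet)
    (e : G.edgeSet) (i : V) :
    N.inject H (Pi.single e 1) i = if e ∈ H then N.orient.incidence i e else 0 := by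
  simp [Plant.inject, Pi.single_apply]

theorem Plant.inject_add (N : Plant G) (H : Finset G.edgeSet) (v w : G.edgeSet → ℝ) (i : V) :
    N.inject H (v + w) i = N.inject H v i + N.inject H w i := by
  simp [Plant.inject, mul_add, Finset.sum_add_distrib]

theorem Plant.inject_smul (N : Plant G) (H : Finset G.edgeSet) (c : ℝ) (v : G.edgeSet → ℝ)
    (i : V) : N.inject H (c • v) i = c * N.inject H v i := by
  simp only [Plant.inject, Pi.smul_apply, smul_eq_mul, Finset.mul_sum]
  exact Finset.sum_congr rfl fun e _ => by ring

/-- The edge flows that act in the same way on the agents through `H` and through `H'`. -/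
def Plant.commonFlows (N : Plant G) (H H' : Finset G.edgeSet) : Submodule ℝ (G.edgeSet → ℝ) where
  carrier := {z | ∀ i, N.inject H z i = N.inject H' z i}
  zero_mem' := by intro i; simp [Plant.inject]
  add_mem' := by
    intro a b ha hb i
    rw [N.inject_add, N.inject_add, ha i, hb i]
  smul_mem' := by
    intro c a ha i
    rw [N.inject_smul, N.inject_smul, ha i]

theorem Plant.commonFlows_ne_top (N : Plant G) {H H' : Finset G.edgeSet} (hne : H ≠ H') :
    N.commonFlows H H' ≠ ⊤ := by
  classical
  intro htop
  refine hne (Finset.ext fun e => ?_)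
  have h : (Pi.single e 1 : G.edgeSet → ℝ) ∈ N.commonFlows H H' := htop ▸ Submodule.mem_top
  have h1 := h (N.orient.fst e)
  rw [N.inject_single, N.inject_single] at h1
  have h2 : N.orient.incidence (N.orient.fst e) e = 1 := by simp [EdgeOrientation.incidence]
  rw [h2] at h1
  by_cases he : e ∈ H <;> by_cases he' : e ∈ H' <;> simp_all

/-- Two different graphs have a common steady-state output only for a null set of biases. A common
output `y` with flows `z = γ(ℰᵀ y) + w` satisfies `κ(y) = -ℰ_H z = -ℰ_{H'} z`. So `z` lies in a proper
subspace, and `w = z - γ(ℰᵀ κ⁻¹(-ℰ_H z))` is the image of `z` under a differentiable map. -/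
theorem Plant.volume_common_steadyOutput [Fintype G.edgeSet] (N : Plant G) {ctrl : G.edgeSet → SISO}
    (hc : N.StandingAssumption ctrl) {H H' : Finset G.edgeSet} (hne : H ≠ H') :
    volume {w : G.edgeSet → ℝ | ∃ y, N.IsSteadyOutput ⟨ctrl, w⟩ H y ∧
      N.IsSteadyOutput ⟨ctrl, w⟩ H' y} = 0 := by
  obtain ⟨-, hsm, hg⟩ := hc
  choose κ hκ hκ' hrel using hsm
  choose g hg hgrel using hg
  set F : (G.edgeSet → ℝ) → G.edgeSet → ℝ := fun z e =>
    z e - g e (N.relOutput (fun i => Function.invFun (κ i) (-N.inject H z i)) e) with hF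
  set s : Set (G.edgeSet → ℝ) :=
    {z | z ∈ N.commonFlows H H' ∧ ∀ i, ∃ y, κ i y = -N.inject H z i}
  have hs0 : volume s = 0 :=
    measure_mono_null (fun z hz => hz.1)
      (Measure.addHaar_submodule volume _ (N.commonFlows_ne_top hne))
  have hFd : DifferentiableOn ℝ F s := by
    intro z hz
    refine DifferentiableAt.differentiableWithinAt (differentiableAt_pi.2 fun e => ?_)
    have hK : ∀ i, DifferentiableAt ℝ
        (fun z : G.edgeSet → ℝ => Function.invFun (κ i) (-N.inject H z i)) z := by
      intro i
      obtain ⟨y, hy⟩ := hz.2 i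
      have h1 : DifferentiableAt ℝ (fun z : G.edgeSet → ℝ => -N.inject H z i) z := by
        unfold Plant.inject
        fun_prop
      refine DifferentiableAt.comp (g := Function.invFun (κ i)) z ?_ h1
      rw [← hy]
      exact differentiableAt_invFun (hκ i) (hκ' i) y
    have hgd : Differentiable ℝ (g e) := (hg e).differentiable one_ne_zero
    exact (differentiableAt_apply e z).sub ((hgd _).comp z ((hK _).sub (hK _)))
  refine measure_mono_null ?_
    (addHaar_image_eq_zero_of_differentiableOn_of_addHaar_eq_zero volume hFd hs0)
  rintro w ⟨y, ⟨u, μ, hu, hμ, hin⟩, ⟨u', μ', hu', hμ', hin'⟩⟩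
  have hH : ∀ i, κ i (y i) = -N.inject H (fun e => g e (N.relOutput y e) + w e) i := by
    intro i
    rw [← (hrel i _ _).1 (hu i), hin i]
    refine congrArg _ (Finset.sum_congr rfl fun e he => ?_)
    simp only [(hgrel e _ _).1 (hμ e he)]
  have hH' : ∀ i, κ i (y i) = -N.inject H' (fun e => g e (N.relOutput y e) + w e) i := by
    intro i
    rw [← (hrel i _ _).1 (hu' i), hin' i]
    refine congrArg _ (Finset.sum_congr rfl fun e he => ?_)
    simp only [(hgrel e _ _).1 (hμ' e he)]
  refine ⟨fun e => g e (N.relOutput y e) + w e,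
    ⟨fun i => neg_injective ((hH i).symm.trans (hH' i)), fun i => ⟨y i, hH i⟩⟩, ?_⟩
  funext e
  have hy : (fun i => Function.invFun (κ i)
      (-N.inject H (fun e => g e (N.relOutput y e) + w e) i)) = y := by
    funext i
    rw [← hH i]
    exact Function.leftInverse_invFun (strictMono_of_deriv_pos (hκ' i)).injective _
  simp only [hF, hy]
  ring

end Network

/-! ### Edge deletions in highly connected graphs -/

section Connectivity

variable {V : Type*} [Fintype V] {G : SimpleGraph V} {k : ℕ}

theorem IsKConnected.connected (hG : IsKConnected G k) (hk : 0 < k) : G.Connected := by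
  have h := hG.2 ∅ (by simpa using hk)
  have huniv : {v : V | v ∉ (∅ : Finset V)} = Set.univ := by ext; simp
  rw [huniv] at h
  exact G.induceUnivIso.connected_iff.1 h

theorem IsKConnected.le_card_edgeSet (hG : IsKConnected G k) (hk : 0 < k) [Fintype G.edgeSet] :
    k ≤ Fintype.card G.edgeSet := by
  have h := (hG.connected hk).card_vert_le_card_edgeSet_add_one
  rw [Nat.card_eq_fintype_card, Nat.card_eq_fintype_card] at h
  have := hG.1
  omega

/-- If at most `k - 2` edges of a `k`-connected graph are faulty, then an equivalence relation that
contains all functioning edges relates all vertices. For fixed `a ≠ b`, one deletes an endpoint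
other than `a` and `b` of every faulty edge; a faulty edge between `a` and `b` is bypassed through
a further vertex. -/
theorem IsKConnected.rel_of_edges (hG : IsKConnected G k) (hk : 2 ≤ k) (F : Finset (Sym2 V))
    (hF : ∀ e ∈ F, e ∈ G.edgeSet) (hcard : F.card ≤ k - 2)
    {R : V → V → Prop} (hR : Equivalence R) (hedge : ∀ a b, G.Adj a b → s(a, b) ∉ F → R a b)
    (a b : V) : R a b := by
  classical
  have hpick : ∀ a b, ∃ pick : Sym2 V → V, ∀ e ∈ F, e ≠ s(a, b) →
      pick e ∈ e ∧ pick e ≠ a ∧ pick e ≠ b := by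
    intro a b
    have : ∀ e : Sym2 V, ∃ c, e ∈ F → e ≠ s(a, b) → c ∈ e ∧ c ≠ a ∧ c ≠ b := by
      intro e
      induction e using Sym2.inductionOn with
      | _ p q =>
        by_cases hp : p = a ∨ p = b
        · refine ⟨q, fun he hne => ⟨Sym2.mem_mk_right p q, ?_⟩⟩
          have hpq : p ≠ q := (hF _ he : G.Adj p q).ne
          rcases hp with rfl | rfl
          · exact ⟨hpq.symm, fun h => hne (by rw [h])⟩
          · exact ⟨fun h => hne (by rw [h, Sym2.eq_swap]), hpq.symm⟩
        · exact ⟨p, fun _ _ => ⟨Sym2.mem_mk_left p q, not_or.1 hp⟩⟩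
    choose pick hpick using this
    exact ⟨pick, hpick⟩
  have hfun : ∀ a b, s(a, b) ∉ F → R a b := by
    intro a b hab
    obtain ⟨pick, hpick⟩ := hpick a b
    have hne : ∀ e ∈ F, e ≠ s(a, b) := fun e he h => hab (h ▸ he)
    have ha : a ∉ F.image pick := fun h => by
      obtain ⟨e, he, h⟩ := Finset.mem_image.1 h
      exact (hpick e he (hne e he)).2.1 h
    have hb : b ∉ F.image pick := fun h => by
      obtain ⟨e, he, h⟩ := Finset.mem_image.1 h
      exact (hpick e he (hne e he)).2.2 h
    have hconn := hG.2 (F.image pick) (by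
      have := Finset.card_image_le (s := F) (f := pick)
      omega)
    obtain ⟨W⟩ := hconn.preconnected ⟨a, ha⟩ ⟨b, hb⟩
    have hwalk : ∀ c d : {v : V | v ∉ F.image pick},
        (G.induce {v : V | v ∉ F.image pick}).Walk c d → R c d := by
      intro c d W
      induction W with
      | nil => exact hR.refl _
      | @cons c c' d hadj _ ih =>
        refine hR.trans (hedge c c' hadj fun hmem => ?_) ih
        have hin : pick s(↑c, ↑c') ∈ F.image pick := Finset.mem_image_of_mem _ hmem
        rcases Sym2.mem_iff.1 (hpick _ hmem (hne _ hmem)).1 with h | h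
        · exact c.2 (h ▸ hin)
        · exact c'.2 (h ▸ hin)
    exact hwalk _ _ W
  by_cases hab : s(a, b) ∈ F
  · obtain ⟨pick, hpick⟩ := hpick a b
    obtain ⟨x, hx⟩ : ∃ x, x ∉ insert a (insert b ((F.erase s(a, b)).image pick)) := by
      by_contra! h
      have h1 := Finset.card_le_card (fun x _ => h x : Finset.univ ⊆ _)
      rw [Finset.card_univ] at h1
      have h2 := Finset.card_insert_le a (insert b ((F.erase s(a, b)).image pick))
      have h3 := Finset.card_insert_le b ((F.erase s(a, b)).image pick)
      have h4 := (Finset.card_image_le (s := F.erase s(a, b)) (f := pick)).trans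
        (Finset.card_le_card (Finset.erase_subset _ _))
      have := hG.1
      omega
    simp only [Finset.mem_insert, not_or] at hx
    obtain ⟨hxa, hxb, hxT⟩ := hx
    have hgood : ∀ c, c = a ∨ c = b → s(c, x) ∉ F := by
      intro c hc hmem
      have hne : s(c, x) ≠ s(a, b) := fun h => by
        have := h ▸ Sym2.mem_mk_right c x
        rcases Sym2.mem_iff.1 this with h | h
        exacts [hxa h, hxb h]
      obtain ⟨h1, h2, h3⟩ := hpick _ hmem hne
      rcases Sym2.mem_iff.1 h1 with h | h
      · rcases hc with rfl | rfl
        exacts [h2 h, h3 h]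
      · exact hxT (h ▸ Finset.mem_image_of_mem _ (Finset.mem_erase.2 ⟨hne, hmem⟩))
    exact hR.trans (hfun a x (hgood a (Or.inl rfl))) (hR.symm (hfun b x (hgood b (Or.inr rfl))))
  · exact hfun a b hab

end Connectivity

/-! ### Existence of controllers -/

/-- The static controller `μ = ζ + a`. -/
def shiftController (a : ℝ) : SISO where
  dim := 0
  f := fun _ _ => 0
  h := fun _ ζ => ζ + a
  continuous_f := continuous_const
  continuous_h := continuous_snd.add continuous_const

theorem shiftController_rel (a ζ μ : ℝ) : (ζ, μ) ∈ (shiftController a).rel ↔ μ = ζ + a :=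
  ⟨fun ⟨_, _, h⟩ => h.symm, fun h => ⟨0, rfl, h.symm⟩⟩

theorem shiftController_isOutputStrictlyMEIP (a : ℝ) :
    (shiftController a).IsOutputStrictlyMEIP := by
  refine ⟨fun p hp => ⟨1, one_pos, 0, ⟨differentiable_const 0, fun _ => le_rfl, fun c => ?_⟩,
    fun x u => ?_⟩, ?_, ?_⟩
  · exact (Set.subsingleton_of_subsingleton (α := StateSpace 0)).isCompact
  · rw [(shiftController_rel a p.1 p.2).1 hp]
    refine le_of_eq ((map_zero _).trans ?_)
    simp only [shiftController]
    ring
  · rintro ⟨ζ, μ⟩ h ⟨ζ', μ'⟩ h'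
    rw [shiftController_rel] at h h'
    simp only [h, h', add_sub_add_right_eq_sub]
    exact mul_self_nonneg _
  · rintro S hS hle ⟨ζ, μ⟩ h
    rw [shiftController_rel]
    have := hS (ζ, μ) h ((ζ + μ - a) / 2, (ζ + μ - a) / 2 + a)
      (hle ((shiftController_rel _ _ _).2 rfl))
    simp only at this
    nlinarith [sq_nonneg (μ - ζ - a)]

theorem SISO.IsOutputStrictlyMEIP.isMEIP {s : SISO} (h : s.IsOutputStrictlyMEIP) : s.IsMEIP :=
  ⟨fun p hp => (h.1 p hp).imp fun _ h => ⟨h.1.le, h.2⟩, h.2⟩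

/-- The primitive of `κ - κ a` that vanishes at `a` is nonnegative and coercive, even if `κ` itself is
bounded. -/
theorem exists_coercive_primitive {κ : ℝ → ℝ} (hκ : Continuous κ) (hmono : StrictMono κ) (a : ℝ) :
    ∃ K : ℝ → ℝ, (∀ y, HasDerivAt K (κ y - κ a) y) ∧ (∀ y, 0 ≤ K y) ∧
      ∀ C, ∃ R, ∀ y, K y ≤ C → |y - a| ≤ R := by
  have hc : Continuous fun s => κ s - κ a := hκ.sub continuous_const
  set K : ℝ → ℝ := fun y => ∫ s in a..y, (κ s - κ a) with hK
  have hd : ∀ y, HasDerivAt K (κ y - κ a) y := fun y => hc.integral_hasStrictDerivAt a y |>.hasDerivAt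
  have hcont : Continuous K := continuous_iff_continuousAt.2 fun y => (hd y).continuousAt
  have hK0 : K a = 0 := by simp [hK]
  -- Slope estimates on either side of `a`.
  have hup : ∀ b y, b ≤ y → (κ b - κ a) * (y - b) ≤ K y - K b := fun b y hby =>
    (convex_Ici b).mul_sub_le_image_sub_of_le_deriv hcont.continuousOn
      (fun s _ => (hd s).differentiableAt.differentiableWithinAt)
      (fun s hs => by
        rw [(hd s).deriv]
        linarith [hmono.monotone (interior_subset hs : s ∈ Set.Ici b)])
      b Set.self_mem_Ici y hby hby
  have hdown : ∀ b y, y ≤ b → K b - K y ≤ (κ b - κ a) * (b - y) := fun b y hyb =>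
    (convex_Iic b).image_sub_le_mul_sub_of_deriv_le hcont.continuousOn
      (fun s _ => (hd s).differentiableAt.differentiableWithinAt)
      (fun s hs => by
        rw [(hd s).deriv]
        linarith [hmono.monotone (interior_subset hs : s ∈ Set.Iic b)])
      y hyb b Set.self_mem_Iic hyb
  have hnn : ∀ y, 0 ≤ K y := by
    intro y
    rcases le_total a y with h | h
    · have := hup a y h
      rw [hK0, sub_self, zero_mul] at this
      linarith
    · have := hdown a y h
      rw [hK0, sub_self, zero_mul] at this
      linarith
  refine ⟨K, hd, hnn, fun C => ?_⟩
  have hm₁ : 0 < κ (a + 1) - κ a := sub_pos.2 (hmono (by linarith))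
  have hm₂ : 0 < κ a - κ (a - 1) := sub_pos.2 (hmono (by linarith))
  refine ⟨1 + |C| / (κ (a + 1) - κ a) + |C| / (κ a - κ (a - 1)), fun y hy => ?_⟩
  have hC := le_abs_self C
  have h₁ : 0 ≤ |C| / (κ (a + 1) - κ a) := by positivity
  have h₂ : 0 ≤ |C| / (κ a - κ (a - 1)) := by positivity
  rw [abs_le]
  constructor
  · by_cases h : a - 1 ≤ y
    · linarith
    · have h3 := hdown (a - 1) y (not_le.1 h).le
      have h4 : (a - 1 - y) * (κ a - κ (a - 1)) ≤ |C| := by nlinarith [hnn (a - 1)]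
      have := (le_div_iff₀ hm₂).2 h4
      linarith
  · by_cases h : y ≤ a + 1
    · linarith
    · have h3 := hup (a + 1) y (not_le.1 h).le
      have h4 : (y - (a + 1)) * (κ (a + 1) - κ a) ≤ |C| := by nlinarith [hnn (a + 1)]
      have := (le_div_iff₀ hm₁).2 h4
      linarith

section Network

variable {V : Type*} {G : SimpleGraph V}

theorem Plant.standingAssumption_shiftController {N : Plant G} (hN : N.AgentAssumption)
    (a : G.edgeSet → ℝ) : N.StandingAssumption fun e => shiftController (a e) := by
  refine ⟨?_, hN.2, fun e => ⟨fun ζ => ζ + a e, contDiff_id.add contDiff_const, fun ζ μ =>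
    shiftController_rel _ _ _⟩⟩
  rcases hN.1 with h | h
  · exact Or.inl ⟨h, fun e => shiftController_isOutputStrictlyMEIP _⟩
  · exact Or.inr ⟨h, fun e => (shiftController_isOutputStrictlyMEIP _).isMEIP⟩

variable [DecidableEq V] [Fintype V]

/-- Every balanced vector of inputs is generated by flows in the functioning edges. -/
theorem Plant.exists_inject_eq (N : Plant G) {k : ℕ} (hk : 2 ≤ k) (hG : IsKConnected G k)
    [Fintype G.edgeSet] [DecidableEq G.edgeSet] {H : Finset G.edgeSet} (hH : Hᶜ.card ≤ k - 2)
    {u : V → ℝ} (hu : ∑ i, u i = 0) : ∃ v, ∀ i, N.inject H v i = u i := by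
  set R : V → V → Prop := fun a b =>
    ∃ v, ∀ i, N.inject H v i = (if a = i then 1 else 0) - if b = i then 1 else 0
  have hR : Equivalence R := by
    refine ⟨fun a => ⟨0, fun i => by simp [Plant.inject]⟩, ?_, ?_⟩
    · rintro a b ⟨v, hv⟩
      exact ⟨(-1 : ℝ) • v, fun i => by rw [N.inject_smul, hv i]; ring⟩
    · rintro a b c ⟨v, hv⟩ ⟨v', hv'⟩
      exact ⟨v + v', fun i => by rw [N.inject_add, hv i, hv' i]; ring⟩
  have hRall : ∀ a b, R a b := by
    refine hG.rel_of_edges hk (Hᶜ.map (Function.Embedding.subtype _)) (fun e he => ?_)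
      (by simpa using hH) hR fun a b hab hF => ?_
    · obtain ⟨e', -, rfl⟩ := Finset.mem_map.1 he
      exact e'.2
    · have hmem : (⟨s(a, b), hab⟩ : G.edgeSet) ∈ H := by
        by_contra hcon
        exact hF (Finset.mem_map.2 ⟨_, Finset.mem_compl.2 hcon, rfl⟩)
      have hfs : R (N.orient.fst ⟨s(a, b), hab⟩) (N.orient.snd ⟨s(a, b), hab⟩) :=
        ⟨Pi.single ⟨s(a, b), hab⟩ 1, fun i => by
          rw [N.inject_single, if_pos hmem, EdgeOrientation.incidence_eq]⟩
      have hspec := N.orient.spec ⟨s(a, b), hab⟩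
      rw [Sym2.eq_iff] at hspec
      rcases hspec with ⟨h1, h2⟩ | ⟨h1, h2⟩ <;> rw [h1, h2] at hfs
      · exact hfs
      · exact hR.symm hfs
  obtain ⟨b⟩ := (hG.connected (by omega)).nonempty
  choose v hv using fun a => hRall a b
  refine ⟨fun e => ∑ a, u a * v a e, fun i => ?_⟩
  have h1 : N.inject H (fun e => ∑ a, u a * v a e) i = ∑ a, u a * N.inject H (v a) i := by
    simp only [Plant.inject, Finset.mul_sum]
    rw [Finset.sum_comm]
    exact Finset.sum_congr rfl fun a _ => Finset.sum_congr rfl fun e _ => by ring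
  rw [h1]
  simp only [hv, mul_sub, Finset.sum_sub_distrib, mul_ite, mul_one, mul_zero]
  split_ifs with h
  · simp [hu]
  · simp

/-- With the static controllers `μ = ζ`, a steady-state output exists for every bias `w`. It minimizes
the sum of the agents' coercive potentials and a quadratic edge potential, which is shifted to
compensate for `w` and for the reference inputs `κ(y⋆)` in the agents' potentials. -/
theorem Plant.exists_isSteadyOutput_shiftController {N : Plant G} (hN : N.HasSmoothInverseRel)
    {H : Finset G.edgeSet} {ystar ustar : V → ℝ}
    (hstar : ∀ i, (ustar i, ystar i) ∈ (N.agent i).toSISO.rel) {v : G.edgeSet → ℝ}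
    (hv : ∀ i, N.inject H v i = ustar i) (w : G.edgeSet → ℝ) :
    ∃ y, N.IsSteadyOutput ⟨fun _ => shiftController 0, w⟩ H y := by
  choose κ hκ hκ' hrel using hN
  choose K hKd hKnn hKc using fun i =>
    exists_coercive_primitive (hκ i).continuous (strictMono_of_deriv_pos (hκ' i)) (ystar i)
  set Φ : (V → ℝ) → ℝ := fun y =>
    ∑ i, K i (y i) + ∑ e ∈ H, (N.relOutput y e + (w e + v e)) ^ 2 / 2 with hΦ
  have hKcont : ∀ i, Continuous (K i) := fun i =>
    continuous_iff_continuousAt.2 fun y => (hKd i y).continuousAt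
  have hΦcont : Continuous Φ := by
    simp only [hΦ, Plant.relOutput]
    fun_prop
  have hKle : ∀ y i, K i (y i) ≤ Φ y := fun y i => by
    have h1 := Finset.single_le_sum (fun j _ => hKnn j (y j)) (Finset.mem_univ i)
    have h2 : 0 ≤ ∑ e ∈ H, (N.relOutput y e + (w e + v e)) ^ 2 / 2 :=
      Finset.sum_nonneg fun e _ => by positivity
    simp only [hΦ]
    linarith
  choose R hRb using fun i => hKc i (Φ ystar)
  set B : Set (V → ℝ) := Set.univ.pi fun i => Metric.closedBall (ystar i) (R i)
  have hmemB : ∀ y, Φ y ≤ Φ ystar → y ∈ B := fun y hy i _ => by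
    rw [Metric.mem_closedBall, Real.dist_eq]
    exact hRb i (y i) ((hKle y i).trans hy)
  obtain ⟨y, -, hmin⟩ := (isCompact_univ_pi fun i =>
    isCompact_closedBall (ystar i) (R i)).exists_isMinOn ⟨ystar, hmemB _ le_rfl⟩ hΦcont.continuousOn
  have hglobal : ∀ y', Φ y ≤ Φ y' := fun y' => by
    by_cases h : Φ y' ≤ Φ ystar
    · exact hmin (hmemB y' h)
    · exact (hmin (hmemB ystar le_rfl)).trans (not_le.1 h).le
  -- Stationarity in the direction of every coordinate.
  have hstat : ∀ i, κ i (y i) - ustar i +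
      N.inject H (fun e => N.relOutput y e + (w e + v e)) i = 0 := by
    intro i
    set φ : ℝ → ℝ := fun t => ∑ j, K j (y j + t * if j = i then 1 else 0) +
      ∑ e ∈ H, (N.relOutput y e + t * N.orient.incidence i e + (w e + v e)) ^ 2 / 2 with hφ
    have hφΦ : ∀ t, φ t = Φ fun j => y j + t * if j = i then 1 else 0 := by
      intro t
      simp only [hφ, hΦ]
      congr 1
      refine Finset.sum_congr rfl fun e _ => ?_
      rw [EdgeOrientation.incidence_eq]
      simp only [Plant.relOutput]
      ring
    have hd : HasDerivAt φ
        (∑ j, (κ j (y j) - κ j (ystar j)) * (if j = i then 1 else 0) +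
          ∑ e ∈ H, (N.relOutput y e + (w e + v e)) * N.orient.incidence i e) 0 := by
      refine HasDerivAt.add (HasDerivAt.fun_sum fun j _ => ?_) (HasDerivAt.fun_sum fun e _ => ?_)
      · have h1 : HasDerivAt (fun t : ℝ => y j + t * if j = i then 1 else 0)
            (if j = i then 1 else 0) 0 := by
          simpa using ((hasDerivAt_id (0 : ℝ)).mul_const (if j = i then (1 : ℝ) else 0)).const_add
            (y j)
        refine HasDerivAt.comp (h₂ := K j) 0 ?_ h1
        simpa using hKd j (y j)
      · have h1 : HasDerivAt (fun t : ℝ => N.relOutput y e + t * N.orient.incidence i e +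
            (w e + v e)) (N.orient.incidence i e) 0 := by
          simpa using (((hasDerivAt_id (0 : ℝ)).mul_const (N.orient.incidence i e)).const_add
            (N.relOutput y e)).add_const (w e + v e)
        refine ((h1.fun_pow 2).div_const 2).congr_deriv ?_
        norm_num
        ring
    have hmin0 : IsLocalMin φ 0 := Eventually.of_forall fun t => by
      rw [hφΦ, hφΦ]
      simpa using hglobal _
    have h0 := hmin0.hasDerivAt_eq_zero hd
    rw [(hrel i _ _).1 (hstar i)]
    simp only [mul_ite, mul_one, mul_zero, Finset.sum_ite_eq', Finset.mem_univ, if_true] at h0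
    rw [← h0]
    exact congrArg _ (Finset.sum_congr rfl fun e _ => mul_comm _ _)
  refine ⟨y, fun i => κ i (y i), fun e => N.relOutput y e, fun i => (hrel i _ _).2 rfl,
    fun e _ => (shiftController_rel _ _ _).2 (add_zero _).symm, fun i => ?_⟩
  have h1 := hstat i
  have h2 : N.inject H (fun e => N.relOutput y e + (w e + v e)) i =
      N.inject H (fun e => N.relOutput y e + w e) i + N.inject H v i := by
    rw [← N.inject_add]
    congr 1
    funext e
    simp [add_assoc]
  rw [h2, hv i] at h1
  simp only
  linarith

/-- All choices of the synthesis algorithm can be made, with static controllers: `μ = ζ` in the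
exploratory phase, and `μ = ζ + a` in the stable phases, where the shift `a` makes `y⋆` a steady-state
output. -/
theorem exists_isValid_synthesisChoice {N : Plant G} (hN : N.AgentAssumption) {k : ℕ} (hk : 2 ≤ k)
    (hG : IsKConnected G k) [Fintype G.edgeSet] [DecidableEq G.edgeSet] {ystar ustar : V → ℝ}
    (hstar : ∀ i, (ustar i, ystar i) ∈ (N.agent i).toSISO.rel) (hsum : ∑ i, ustar i = 0) :
    ∃ c : SynthesisChoice N (k - 2), c.IsValid ystar := by
  choose v hv using fun j : FaultyGraph G (k - 2) => N.exists_inject_eq hk hG j.2 hsum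
  refine ⟨⟨fun _ => shiftController 0,
    fun j e => shiftController (-v j e - N.relOutput ystar e),
    fun j => Module.finrank ℝ (N.cycleSpace j.1), fun j => Module.finBasis ℝ _⟩, ?_, ?_, ?_⟩
  · exact N.standingAssumption_shiftController hN 0
  · exact fun w j => Plant.exists_isSteadyOutput_shiftController hN.2 hstar (hv j) w
  · intro j
    have h1 := Plant.standingAssumption_shiftController hN
      fun e => -v j e - N.relOutput ystar e
    have h2 : N.IsSteadyOutput
        ⟨fun e => shiftController (-v j e - N.relOutput ystar e), 0⟩ j.1 ystar := by
      refine ⟨ustar, fun e => -v j e, hstar, fun e _ => (shiftController_rel _ _ _).2 (by ring),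
        fun i => ?_⟩
      rw [← hv j i]
      simp [Plant.inject]
    exact ⟨h1, h2, N.convergesTo_of_isSteadyOutput _ _ h1 h2⟩

end Network

/-! ### Runs of the in-run protocol -/

section InRun

variable {V : Type*} {G : SimpleGraph V} [Fintype G.edgeSet] [DecidableEq G.edgeSet] {r : ℕ}

theorem exploreTime_subsingleton (N : Plant G) (A : Assertion N) (d : SynthesisOutput G r)
    (z : ℝ → N.AgentState × d.explore.CtrlState) :
    {j | exploreDuration N A d z < exploreTime N A d z j}.Subsingleton := by
  intro j hj j' hj'
  have hmin : exploreDuration N A d z < min (exploreTime N A d z j) (exploreTime N A d z j') :=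
    lt_min hj hj'
  obtain ⟨t, ht, hlt⟩ := sInf_lt_iff.1 hmin
  exact ht (lt_of_lt_of_le hlt (min_le_left _ _)) (lt_of_lt_of_le hlt (min_le_right _ _))

theorem exists_exploreTime_eq_top (N : Plant G) (A : Assertion N) (d : SynthesisOutput G r)
    (z : ℝ → N.AgentState × d.explore.CtrlState) (h : exploreDuration N A d z = ⊤) :
    ∃ j j', j ≠ j' ∧ exploreTime N A d z j = ⊤ ∧ exploreTime N A d z j' = ⊤ := by
  by_contra! hcon
  set τ : FaultyGraph G r → ℝ≥0∞ := fun j =>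
    if exploreTime N A d z j = ⊤ then 0 else exploreTime N A d z j with hτ
  have hlt : Finset.univ.sup τ < ⊤ := by
    rw [Finset.sup_lt_iff (by simp)]
    intro j _
    simp only [hτ]
    split_ifs with hj
    · simp
    · exact lt_top_iff_ne_top.2 hj
  have htop : ∀ j, Finset.univ.sup τ < exploreTime N A d z j → exploreTime N A d z j = ⊤ := by
    intro j hj
    by_contra hne
    refine absurd (Finset.le_sup (f := τ) (Finset.mem_univ j)) (not_le.2 ?_)
    simpa only [hτ, if_neg hne] using hj
  refine absurd h (ne_of_lt (lt_of_le_of_lt (sInf_le fun j hj j' hj' => ?_) hlt))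
  by_contra hne
  exact hcon j j' hne (htop j hj) (htop j' hj')

variable [DecidableEq V] {N : Plant G} {A : Assertion N} {d : SynthesisOutput G r} {ystar : V → ℝ}

/-- While the functioning graph is `j₀`, the instance of the assertion algorithm for `j₀` does not
stop. So the stable phase `j₀` does not end, and the exploratory phase can only end with `j₀`. -/
theorem phase_of_constant_graph (hA : IsConvergenceAssertion N A)
    (hstab : ∀ j, N.StandingAssumption (d.IP j).ctrl ∧ N.ConvergesTo (d.IP j) j.1 ystar)
    (hexp : N.StandingAssumption d.explore.ctrl)
    (hlim : ∀ j, N.ConvergesTo d.explore j.1 (d.SSLimits j)) (j₀ : FaultyGraph G r)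
    {m m' : Phase G r} {z : ℝ → N.AgentState × (d.protocol m).CtrlState}
    (htraj : N.IsTrajectoryOn (d.protocol m) (fun _ => j₀.1)
      {s | 0 ≤ s ∧ ENNReal.ofReal s ≤ phaseDuration N A d ystar m z}
      (fun s => (z s).1) (fun s => (z s).2))
    (hfin : phaseDuration N A d ystar m z ≠ ⊤) (hnext : IsNextPhase N A d m z m') :
    (∃ j, m = .stable j ∧ j ≠ j₀ ∧ m' = .explore) ∨ (m = .explore ∧ m' = .stable j₀) := by
  set D := phaseDuration N A d ystar m z
  have hset : {s | 0 ≤ s ∧ ENNReal.ofReal s ≤ D} = Set.Icc 0 D.toReal := by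
    ext s
    exact and_congr_right fun _ => ENNReal.ofReal_le_iff_le_toReal hfin
  rw [hset] at htraj
  cases m with
  | stable j =>
    refine Or.inl ⟨j, rfl, ?_, hnext⟩
    rintro rfl
    have h := hA.no_false_positive _ _ ystar _ _ D.toReal (hstab j).1 ENNReal.toReal_nonneg
      (hstab j).2 htraj
    rw [ENNReal.ofReal_toReal hfin] at h
    exact lt_irrefl _ h
  | explore =>
    refine Or.inr ⟨rfl, ?_⟩
    have h : D < exploreTime N A d z j₀ := by
      have h := hA.no_false_positive _ _ _ _ _ D.toReal hexp ENNReal.toReal_nonneg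
        (hlim j₀) htraj
      rwa [ENNReal.ofReal_toReal hfin] at h
    rcases hnext with ⟨-, hall⟩ | ⟨j, rfl, hj⟩
    · exact absurd h (not_lt.2 (hall j₀))
    · rw [exploreTime_subsingleton N A d z hj h]

/-- During a phase that does not end, the output converges to `y⋆`. An exploratory phase does not
go on forever, because the output cannot have two different limits. -/
theorem tendsto_of_endless_phase (hA : IsConvergenceAssertion N A)
    (hstab : ∀ j, N.StandingAssumption (d.IP j).ctrl ∧ N.ConvergesTo (d.IP j) j.1 ystar)
    (hexp : N.StandingAssumption d.explore.ctrl) (hinj : Function.Injective d.SSLimits)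
    {m : Phase G r} {z : ℝ → N.AgentState × (d.protocol m).CtrlState} {σ : ℝ → Finset G.edgeSet}
    (hσ : AntitoneOn σ (Set.Ici 0))
    (htraj : N.IsTrajectoryOn (d.protocol m) σ (Set.Ici 0) (fun s => (z s).1) (fun s => (z s).2))
    (htop : phaseDuration N A d ystar m z = ⊤) :
    Tendsto (fun t => N.output (z t).1) atTop (𝓝 ystar) := by
  cases m with
  | stable j =>
    by_contra hcon
    exact hA.no_false_negative j.1 _ ystar σ _ _ (hstab j).1 hσ htraj hcon htop
  | explore =>
    obtain ⟨j, j', hne, hj, hj'⟩ := exists_exploreTime_eq_top N A d z htop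
    have hto : ∀ j, exploreTime N A d z j = ⊤ →
        Tendsto (fun t => N.output (z t).1) atTop (𝓝 (d.SSLimits j)) := by
      intro j hj
      by_contra hcon
      exact hA.no_false_negative j.1 _ (d.SSLimits j) σ _ _ hexp hσ htraj hcon hj
    exact absurd (hinj (tendsto_nhds_unique (hto j hj) (hto j' hj'))) hne

/-- A run has only finitely many phases, since from some phase on the functioning graph does not
change within a phase, and then at most two phases end. So it has an endless phase. -/
theorem InRun.tendsto_output (hA : IsConvergenceAssertion N A)
    (hstab : ∀ j, N.StandingAssumption (d.IP j).ctrl ∧ N.ConvergesTo (d.IP j) j.1 ystar)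
    (hexp : N.StandingAssumption d.explore.ctrl)
    (hlim : ∀ j, N.ConvergesTo d.explore j.1 (d.SSLimits j))
    (hinj : Function.Injective d.SSLimits) {ς : ℝ → Finset G.edgeSet}
    (hς : AntitoneOn ς (Set.Ici 0)) (hr : ∀ t, 0 ≤ t → (ς t)ᶜ.card ≤ r)
    (R : InRun N A d ystar ς) : Tendsto (fun t => N.output (R.x t)) atTop (𝓝 ystar) := by
  have hmeas : ∀ n, R.meas n = fun s => (R.x ((R.start n).toReal + s), R.η n s) :=
    fun n => funext (R.meas_eq n)
  have hnonneg : ∀ n, 0 ≤ (R.start n).toReal := fun n => ENNReal.toReal_nonneg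
  by_cases hend : ∃ n, R.start n = ⊤
  · obtain ⟨n, hn, hn'⟩ : ∃ n, R.start n ≠ ⊤ ∧ R.start (n + 1) = ⊤ := by
      classical
      have h0 : Nat.find hend ≠ 0 := fun h => by
        have := Nat.find_spec hend
        rw [h, R.start_zero] at this
        exact ENNReal.zero_ne_top this
      obtain ⟨n, hn⟩ := Nat.exists_eq_succ_of_ne_zero h0
      have hspec := Nat.find_spec hend
      rw [hn] at hspec
      exact ⟨n, Nat.find_min hend (by omega), hspec⟩
    have htop : phaseDuration N A d ystar (R.phase n) (R.meas n) = ⊤ := by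
      rw [R.start_succ n, ENNReal.add_eq_top] at hn'
      exact hn'.resolve_left hn
    have htraj := R.trajectory n hn
    have hset : {s : ℝ | 0 ≤ s ∧ ENNReal.ofReal s ≤
        phaseDuration N A d ystar (R.phase n) (R.meas n)} = Set.Ici 0 := by
      ext s
      rw [htop]
      exact and_iff_left le_top
    rw [hset] at htraj
    have hconv := tendsto_of_endless_phase hA hstab hexp hinj (z := R.meas n)
      (σ := fun s => ς ((R.start n).toReal + s))
      (fun a ha b hb hab => hς (add_nonneg (hnonneg n) ha) (add_nonneg (hnonneg n) hb)
        (by simpa using hab)) (by rw [hmeas n]; exact htraj) htop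
    rw [hmeas n] at hconv
    refine (hconv.comp (tendsto_atTop_add_const_right atTop (-(R.start n).toReal)
      tendsto_id)).congr fun t => ?_
    simp
  · exfalso
    push Not at hend
    have hle : ∀ n, R.start n ≤ R.start (n + 1) := fun n => by
      rw [R.start_succ n]
      exact le_self_add
    have hmono : Monotone fun n => (R.start n).toReal := monotone_nat_of_le_succ fun n =>
      ENNReal.toReal_mono (hend _) (hle n)
    -- The functioning graphs at the starting times of the phases are eventually constant.
    obtain ⟨n₀, hn₀⟩ := WellFoundedGT.monotone_chain_condition
      (α := (Finset G.edgeSet)ᵒᵈ) ⟨fun n => OrderDual.toDual (ς (R.start n).toReal), fun a b hab =>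
        hς (hnonneg a) (hnonneg b) (hmono hab)⟩
    set j₀ : FaultyGraph G r := ⟨ς (R.start n₀).toReal, hr _ (hnonneg _)⟩
    have hstep : ∀ n, n₀ ≤ n →
        (∃ j, R.phase n = .stable j ∧ j ≠ j₀ ∧ R.phase (n + 1) = .explore) ∨
          (R.phase n = .explore ∧ R.phase (n + 1) = .stable j₀) := by
      intro n hn
      have hfin : phaseDuration N A d ystar (R.phase n) (R.meas n) ≠ ⊤ := fun h => by
        refine hend (n + 1) ?_
        rw [R.start_succ n, h, add_top]
      have hconst : ∀ s, 0 ≤ s →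
          ENNReal.ofReal s ≤ phaseDuration N A d ystar (R.phase n) (R.meas n) →
          ς ((R.start n).toReal + s) = j₀.1 := by
        intro s hs hsD
        have h1 : (R.start n).toReal + s ≤ (R.start (n + 1)).toReal := by
          rw [R.start_succ n, ENNReal.toReal_add (hend n) hfin]
          gcongr
          exact (ENNReal.ofReal_le_iff_le_toReal hfin).1 hsD
        have h2 : ς (R.start n).toReal = j₀.1 := (hn₀ n hn).symm
        have h3 : ς (R.start (n + 1)).toReal = j₀.1 := (hn₀ (n + 1) (hn.trans n.le_succ)).symm
        refine le_antisymm ?_ ?_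
        · rw [← h2]
          exact hς (hnonneg n) (add_nonneg (hnonneg n) hs) (le_add_of_nonneg_right hs)
        · rw [← h3]
          exact hς (add_nonneg (hnonneg n) hs) (hnonneg (n + 1)) h1
      refine phase_of_constant_graph hA hstab hexp hlim j₀ (z := R.meas n) ?_ hfin
        (R.phase_succ n (hend _))
      obtain ⟨hx, hη, hode⟩ := R.trajectory n (hend n)
      have hfst : (fun s => (R.meas n s).1) = fun s => R.x ((R.start n).toReal + s) :=
        funext fun s => by rw [R.meas_eq]
      have hsnd : (fun s => (R.meas n s).2) = R.η n := funext fun s => by rw [R.meas_eq]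
      rw [hfst, hsnd]
      refine ⟨hx, fun e => (hη e).mono fun s hs => ⟨hs.1, ?_⟩, fun t ht _ => ?_⟩
      · have := hs.2
        rwa [← hconst s hs.1.1 hs.1.2] at this
      · have hcs : ∀ s ∈ interior {s | 0 ≤ s ∧ ENNReal.ofReal s ≤
            phaseDuration N A d ystar (R.phase n) (R.meas n)},
            ς ((R.start n).toReal + s) = j₀.1 := fun s hs =>
          hconst s (interior_subset hs).1 (interior_subset hs).2
        have h := hode t ht (by
          filter_upwards [isOpen_interior.mem_nhds ht] with s hs
          rw [hcs s hs, hcs t ht])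
        simp only [hcs t ht] at h
        exact h
    have hstable : ∀ n, n₀ ≤ n → R.phase n ≠ .stable j₀ := by
      intro n hn h
      rcases hstep n hn with ⟨j, hj, hne, -⟩ | ⟨hj, -⟩
      · rw [h] at hj
        exact hne (Phase.stable.inj hj).symm
      · rw [h] at hj
        cases hj
    have hexplore : ∀ n, n₀ ≤ n → R.phase n ≠ .explore := by
      intro n hn h
      rcases hstep n hn with ⟨j, hj, -, -⟩ | ⟨-, hj⟩
      · rw [h] at hj
        cases hj
      · exact hstable (n + 1) (hn.trans n.le_succ) hj
    rcases hstep n₀ le_rfl with ⟨j, -, -, hj⟩ | ⟨hj, -⟩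
    · exact hexplore (n₀ + 1) n₀.le_succ hj
    · exact hexplore n₀ le_rfl hj

end InRun

end NetworkFDI

theorem mainTheorem4 {V : Type*} [Fintype V] [DecidableEq V] (G : SimpleGraph V)
    [DecidableRel G.Adj] (N : NetworkFDI.Plant G) (hN : N.AgentAssumption)
    (k : ℕ) (hk : 3 ≤ k) (hG : NetworkFDI.IsKConnected G k)
    (ystar : V → ℝ)
    (hystar : ∃ u : V → ℝ, (∀ i, (u i, ystar i) ∈ (N.agent i).toSISO.rel) ∧ ∑ i, u i = 0) :
    k - 2 < Fintype.card G.edgeSet ∧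
    (∃ c : NetworkFDI.SynthesisChoice N (k - 2), c.IsValid ystar) ∧
    ∀ c : NetworkFDI.SynthesisChoice N (k - 2), c.IsValid ystar →
    ∀ A : NetworkFDI.Assertion N, NetworkFDI.IsConvergenceAssertion N A →
    ∀ (Ω : Type*) [MeasurableSpace Ω] (P : Measure Ω) [IsProbabilityMeasure P]
      (w : Ω → G.edgeSet → ℝ)
      (α : ∀ j : NetworkFDI.FaultyGraph G (k - 2), Ω → Fin (c.basisDim j) → ℝ),
      ProbabilityTheory.IsGaussian (P.map w) → P.map w ≪ volume →
      (∀ j, ProbabilityTheory.IsGaussian (P.map (α j)) ∧ P.map (α j) ≪ volume) →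
    ∀ᵐ ω ∂P,
      ∀ lim : NetworkFDI.FaultyGraph G (k - 2) → V → ℝ,
        (∀ j, N.IsSteadyOutput ⟨c.exploreCtrl, w ω⟩ j.1 (lim j)) →
      ∀ ς : ℝ → Finset G.edgeSet, AntitoneOn ς (Set.Ici 0) →
        (∀ t, 0 ≤ t → (ς t)ᶜ.card ≤ k - 2) →
      ∀ R : NetworkFDI.InRun N A (c.toOutput (w ω) (fun j => α j ω) lim) ystar ς,
        Tendsto (fun t => N.output (R.x t)) atTop (𝓝 ystar) := by
  obtain ⟨ustar, hstar, hsum⟩ := hystar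
  have hcard := hG.le_card_edgeSet (by omega)
  refine ⟨by omega, NetworkFDI.exists_isValid_synthesisChoice hN (by omega) hG hstar hsum, ?_⟩
  intro c hc A hA Ω _ P _ w α hw hwac _
  have hwm : AEMeasurable w P := by
    have : IsProbabilityMeasure (P.map w) := inferInstance
    exact AEMeasurable.of_map_ne_zero this.ne_zero
  have hgen : ∀ᵐ ω ∂P, ∀ j j' : NetworkFDI.FaultyGraph G (k - 2), j ≠ j' →
      ¬ ∃ y, N.IsSteadyOutput ⟨c.exploreCtrl, w ω⟩ j.1 y ∧
        N.IsSteadyOutput ⟨c.exploreCtrl, w ω⟩ j'.1 y := by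
    refine ae_all_iff.2 fun j => ae_all_iff.2 fun j' => ?_
    by_cases hne : j = j'
    · exact Eventually.of_forall fun ω h => absurd hne h
    · have h0 := N.volume_common_steadyOutput hc.explore_assumption
        (fun h => hne (Subtype.ext h) : j.1 ≠ j'.1)
      have h1 : ∀ᵐ v ∂(P.map w), ¬ ∃ y, N.IsSteadyOutput ⟨c.exploreCtrl, v⟩ j.1 y ∧
          N.IsSteadyOutput ⟨c.exploreCtrl, v⟩ j'.1 y := by
        rw [ae_iff]
        simpa only [not_not] using hwac h0
      filter_upwards [ae_of_ae_map hwm h1] with ω hω _ using hω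
  filter_upwards [hgen] with ω hω lim hlim ς hς hr R
  refine R.tendsto_output hA (fun j => ⟨(hc.stable_synthesis j).1, ?_⟩) hc.explore_assumption
    (fun j => N.convergesTo_of_isSteadyOutput _ _ hc.explore_assumption (hlim j))
    (fun j j' h => ?_) hς hr
  · -- The bias of a stable phase is invisible to the agents.
    obtain ⟨u, μ, h1, h2, h3⟩ := (hc.stable_synthesis j).2.1
    refine N.convergesTo_of_isSteadyOutput _ _ (hc.stable_synthesis j).1 ⟨u, μ, h1, h2, fun i => ?_⟩
    have hker : ∑ a, α j ω a • (c.basis j a : G.edgeSet → ℝ) ∈ N.cycleSpace j.1 :=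
      Submodule.sum_mem _ fun a _ => Submodule.smul_mem _ _ (c.basis j a).2
    have h4 := N.inject_add j.1 μ (∑ a, α j ω a • (c.basis j a : G.edgeSet → ℝ)) i
    rw [hker i, add_zero] at h4
    rw [h3 i]
    simp only [Pi.zero_apply, add_zero]
    exact congrArg Neg.neg h4.symm
  · by_contra hne
    exact hω j j' hne ⟨lim j, hlim j, by
      have : lim j = lim j' := h
      rw [this]
      exact hlim j'⟩
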